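/- **Theorem 2.1.** Let $$p(z)=a_0\prod_{k=1}^{d}(z-\lambda_k)^{n_k},\qquad a_0\in\mathbb R\setminus\{0\},\quad \lambda_1<\lambda_2<\dots<\lambda_d \text{ real},\quad n_k\ge 1,$$ be a real polynomial with only real zeroes, with $d\ge 4$ distinct zeroes, and of degree $n=n_1+\dots+n_d$. Let $m_1<m_2<\dots<m_r$ be the distinct values taken by the multiplicities $n_2,\dots,n_{d-1}$ of the interior zeroes $\lambda_2,\dots,\lambda_{d-1}$, suppose that $r\ge 2$, and let $d_j$ be the number of indices $k\in\{2,\dots,d-1\}$ with $n_k=m_j$. For $\varkappa\in\mathbb R$ put $F_\varkappa[p]=p\,p''-\varkappa\,(p')^2$, and let $Z_C(F_\varkappa[p])$ be the number of non-real complex zeroes of $F_\varkappa[p]$, counted with multiplicity. Then the following hold. 1. If $\varkappa\le\frac{m_1-1}{m_1}$, then $Z_C(F_\varkappa[p])=0$. 2. If $\frac{m_j-1}{m_j}<\varkappa\le\frac{m_{j+1}-1}{m_{j+1}}$ for some $j\in\{1,\dots,r-1\}$, then $0\le Z_C(F_\varkappa[p])\le 2\sum_{i=1}^{j}d_i$.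 3. If $\frac{m_r-1}{m_r}<\varkappa<\frac{n-d+1}{n-d+2}$, then $0\le Z_C(F_\varkappa[p])\le 2d-4$. 4. If $\frac{n-d+k-1}{n-d+k}\le\varkappa<\frac{n-d+k}{n-d+k+1}$ for some $k\in\{2,\dots,d-1\}$, then $2k-2\le Z_C(F_\varkappa[p])\le 2d-4$. 5. If $\varkappa=\frac{n-1}{n}$, then $Z_C(F_\varkappa[p])=2d-4$. 6. If $\varkappa>\frac{n-1}{n}$, then $Z_C(F_\varkappa[p])=2d-2$. -/

import Mathlib

noncomputable section

open Polynomial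

/-- The differential polynomial `F_κ[p] = p p'' - κ (p')²`. -/
def diffPoly (κ : ℝ) (p : ℝ[X]) : ℝ[X] :=
  p * derivative (derivative p) - C κ * derivative p ^ 2

/-- `Z_C(f)`: the number of non-real complex zeroes of the real polynomial `f`,
counted with multiplicity. -/
def nonrealZeroCount (f : ℝ[X]) : ℕ :=
  Multiset.card ((f.map (algebraMap ℝ ℂ)).roots.filter fun z => z.im ≠ 0)

/-- For zeroes numbered `1, …, d` in increasing order, with multiplicities `mult 1, …, mult d`,
the number of interior zeroes (those numbered `2, …, d - 1`) whose multiplicity is `m`. -/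
def interiorCount (d : ℕ) (mult : ℕ → ℕ) (m : ℕ) : ℕ :=
  ((Finset.Icc 2 (d - 1)).filter fun k => mult k = m).card

end

open Polynomial Filter Topology

/-! Write F for F_κ[p]. At a zero of p of multiplicity m, F is (z - λ)^(2m-2) times a factor whose
value at λ has the sign of m - 1 - κm (`exists_diffPoly_eq_pow_mul`). By Laguerre's inequality F < 0
at every critical point that is not a zero of p. If κ < (n-1)/n, then F has degree 2n - 2 and is
positive near ±∞.

Upper bounds: cut the line at the critical points between the zeroes of p. Parity and sign changes
give at least 2m real zeroes in an interior piece with m - 1 - κm ≥ 0, at least 2m - 2 in the other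
interior pieces, and at least 2m - 1 in the two outer ones. So the non-real zeroes number at most
twice the interior zeroes with m - 1 - κm < 0 (`two_mul_sum_le_zeroCountOn_diffPoly`).

Lower bounds: real zeroes of F off those of p must be few. With κ' = 2 - 1/κ, the derivative of
F·|p'|^(-κ') is governed by p·F_κ'[p'] (`mul_diffPoly_derivative`). Rolle and parity then show that
this count does not decrease when (p, κ) is replaced by (p', κ'). For κ = 1 - 1/ν the step is ν ↦ ν
- 1, and it is iterated until ν ≤ 2 (`zeroCountOn_diffPoly_le_of_sub_le`).

Large κ: n·F/p² is ((1-κ)n - 1)(p'/p)² minus a weighted variance of the numbers 1/(x - λ_k). Hence F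
< 0 off the zeroes of p once κ ≥ (n-1)/n, and the real zeroes are known exactly. Only the degree
remains: 2n - 4 at equality, 2n - 2 beyond. -/

/-! ### Counting real zeroes: additivity, parity, Rolle. -/

open Classical in
/-- The number of zeroes of `f` in the set `s`, counted with multiplicity. -/
noncomputable def zeroCountOn (f : ℝ[X]) (s : Set ℝ) : ℕ :=
  Multiset.card (f.roots.filter (· ∈ s))

theorem zeroCountOn_mono (f : ℝ[X]) {s t : Set ℝ} (h : s ⊆ t) :
    zeroCountOn f s ≤ zeroCountOn f t := by
  classical
  exact Multiset.card_le_card (Multiset.monotone_filter_right _ fun x hx => h hx)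

theorem zeroCountOn_union (f : ℝ[X]) {s t : Set ℝ} (h : Disjoint s t) :
    zeroCountOn f (s ∪ t) = zeroCountOn f s + zeroCountOn f t := by
  classical
  have h2 : f.roots.filter (fun x => x ∈ s ∧ x ∈ t) = 0 := by
    rw [Multiset.filter_eq_nil]
    rintro x - ⟨hs, ht⟩
    exact Set.disjoint_left.1 h hs ht
  have := Multiset.filter_add_filter (· ∈ s) (· ∈ t) f.roots
  rw [h2, add_zero] at this
  unfold zeroCountOn
  rw [← Multiset.card_add, this]
  congr 1
  ext x
  simp only [Multiset.count_filter, Set.mem_union]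

theorem zeroCountOn_univ (f : ℝ[X]) : zeroCountOn f Set.univ = Multiset.card f.roots := by
  classical
  simp [zeroCountOn]

theorem zeroCountOn_mul {f g : ℝ[X]} (h : f * g ≠ 0) (s : Set ℝ) :
    zeroCountOn (f * g) s = zeroCountOn f s + zeroCountOn g s := by
  classical
  simp [zeroCountOn, roots_mul h]

theorem zeroCountOn_eq_zero {f : ℝ[X]} {s : Set ℝ} (h : ∀ x ∈ s, f.eval x ≠ 0) :
    zeroCountOn f s = 0 := by
  classical
  rw [zeroCountOn, Multiset.card_eq_zero, Multiset.filter_eq_nil]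
  intro x hx hs
  exact h x hs (isRoot_of_mem_roots hx)

theorem zeroCountOn_pos {f : ℝ[X]} (hf : f ≠ 0) {s : Set ℝ} {x : ℝ} (hx : x ∈ s)
    (h : f.eval x = 0) : 0 < zeroCountOn f s := by
  classical
  rw [zeroCountOn, Multiset.card_pos_iff_exists_mem]
  exact ⟨x, Multiset.mem_filter.2 ⟨(mem_roots hf).2 h, hx⟩⟩

theorem zeroCountOn_X_sub_C_pow {s : Set ℝ} {x : ℝ} (hx : x ∈ s) (m : ℕ) :
    zeroCountOn ((X - C x) ^ m) s = m := by
  classical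
  simp [zeroCountOn, roots_pow, roots_X_sub_C, Multiset.filter_nsmul, Multiset.filter_singleton, hx]

theorem zeroCountOn_eq_sum (f : ℝ[X]) (s : Set ℝ) [DecidablePred (· ∈ s)] :
    zeroCountOn f s = ∑ x ∈ f.roots.toFinset.filter (· ∈ s), f.rootMultiplicity x := by
  have h : zeroCountOn f s = Multiset.card (f.roots.filter (· ∈ s)) := by
    unfold zeroCountOn
    congr!
  rw [h, ← Multiset.toFinset_sum_count_eq, Multiset.toFinset_filter]
  refine Finset.sum_congr (by ext; simp) fun x hx => ?_
  rw [Multiset.count_filter_of_pos (Finset.mem_filter.1 hx).2, count_roots]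

theorem zeroCountOn_finset (f : ℝ[X]) (s : Finset ℝ) :
    zeroCountOn f (s : Set ℝ) = ∑ x ∈ s, f.rootMultiplicity x := by
  classical
  rw [zeroCountOn_eq_sum]
  refine Finset.sum_subset (fun x hx => by simpa using (Finset.mem_filter.1 hx).2) ?_
  intro x hx hx'
  rw [← count_roots, Multiset.count_eq_zero]
  intro h
  exact hx' (Finset.mem_filter.2 ⟨Multiset.mem_toFinset.2 h, by simpa using hx⟩)

theorem eval_mul_eval_pos_of_ne_zero {f : ℝ[X]} {a b : ℝ} (hab : a ≤ b)
    (h : ∀ x ∈ Set.Icc a b, f.eval x ≠ 0) : 0 < f.eval a * f.eval b := by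
  by_contra! hn
  have h0 : (0 : ℝ) ∈ Set.uIcc (f.eval a) (f.eval b) := by
    rw [Set.mem_uIcc]
    rcases mul_nonpos_iff.1 hn with h | h
    · exact Or.inr ⟨h.2, h.1⟩
    · exact Or.inl h
  obtain ⟨x, hx, hx0⟩ := intermediate_value_uIcc f.continuous.continuousOn h0
  rw [Set.uIcc_of_le hab] at hx
  exact h x hx hx0

/-- Dividing out a root inside the interval flips both the parity and the sign of the product of the
end values. -/
theorem even_zeroCountOn_Ioo_iff {f : ℝ[X]} {a b : ℝ} (hab : a < b) (ha : f.eval a ≠ 0)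
    (hb : f.eval b ≠ 0) : Even (zeroCountOn f (Set.Ioo a b)) ↔ 0 < f.eval a * f.eval b := by
  induction hn : f.natDegree using Nat.strong_induction_on generalizing f with
  | _ n ih =>
  by_cases h : ∃ x ∈ Set.Ioo a b, f.eval x = 0
  · obtain ⟨x, hx, hx0⟩ := h
    obtain ⟨g, rfl⟩ := dvd_iff_isRoot.2 hx0
    have hne : (X - C x) * g ≠ 0 := by
      intro h; rw [h] at ha; simp at ha
    have hg : g ≠ 0 := right_ne_zero_of_mul hne
    rw [zeroCountOn_mul hne]
    have h1 := zeroCountOn_X_sub_C_pow hx 1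
    rw [pow_one] at h1
    rw [natDegree_mul (X_sub_C_ne_zero x) hg, natDegree_X_sub_C] at hn
    simp only [eval_mul, eval_sub, eval_X, eval_C] at ha hb ⊢
    have := ih g.natDegree (by omega) (right_ne_zero_of_mul ha) (right_ne_zero_of_mul hb) rfl
    rw [h1, add_comm, Nat.even_add_one, this]
    have e1 : a - x < 0 := by linarith [hx.1]
    have e2 : 0 < b - x := by linarith [hx.2]
    have e3 : (a - x) * g.eval a * ((b - x) * g.eval b)
      = ((a - x) * (b - x)) * (g.eval a * g.eval b) := by ring
    have e4 : (a - x) * (b - x) < 0 := mul_neg_of_neg_of_pos e1 e2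
    rw [e3, not_lt]
    have e5 : g.eval a * g.eval b ≠ 0 :=
      mul_ne_zero (right_ne_zero_of_mul ha) (right_ne_zero_of_mul hb)
    constructor
    · intro h
      exact mul_pos_of_neg_of_neg e4 (lt_of_le_of_ne h e5)
    · intro h
      by_contra! h'
      exact absurd h (not_lt.2 (mul_nonpos_of_nonpos_of_nonneg e4.le h'.le))
  · push Not at h
    rw [zeroCountOn_eq_zero h]
    simp only [Even.zero, true_iff]
    refine eval_mul_eval_pos_of_ne_zero hab.le fun x hx => ?_
    rcases eq_or_lt_of_le hx.1 with rfl | h1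
    · exact ha
    rcases eq_or_lt_of_le hx.2 with rfl | h2
    · exact hb
    exact h x ⟨h1, h2⟩

/-- Rolle's theorem for `f * |w| ^ (-t)`, with multiplicities. -/
theorem zeroCountOn_Ioo_le_of_mul_eq {f g c w : ℝ[X]} {t a b : ℝ} (hg : g ≠ 0)
    (h : c * g = w * derivative f - C t * derivative w * f)
    (hc : ∀ x ∈ Set.Ioo a b, c.eval x ≠ 0) (hw : ∀ x ∈ Set.Ioo a b, w.eval x ≠ 0) :
    zeroCountOn f (Set.Ioo a b) ≤ zeroCountOn g (Set.Ioo a b) + 1 := by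
  classical
  rcases eq_or_ne f 0 with rfl | hf
  · simp [zeroCountOn]
  set S := f.roots.toFinset.filter (· ∈ Set.Ioo a b) with hS
  set T := g.roots.toFinset.filter (· ∈ Set.Ioo a b) with hT
  have hmult : ∀ x ∈ S, f.rootMultiplicity x ≤ g.rootMultiplicity x + 1 := by
    intro x hx
    have hxI := (Finset.mem_filter.1 hx).2
    rw [← tsub_le_iff_right, le_rootMultiplicity_iff hg]
    -- Differentiation lowers a multiplicity by at most one, and `c` has no zero at `x` to absorb
    -- the remaining factor.
    have hcop : IsCoprime ((X - C x) ^ (f.rootMultiplicity x - 1)) c := by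
      apply IsCoprime.pow_left
      rw [(prime_X_sub_C x).irreducible.coprime_iff_not_dvd]
      rw [dvd_iff_isRoot]
      exact hc x hxI
    refine hcop.dvd_of_dvd_mul_left ?_
    rw [h]
    refine dvd_sub (Dvd.dvd.mul_left ?_ _) (Dvd.dvd.mul_left ?_ _)
    · by_cases hd : derivative f = 0
      · rw [hd]; exact dvd_zero _
      · rw [← le_rootMultiplicity_iff hd]
        exact rootMultiplicity_sub_one_le_derivative_rootMultiplicity _ _
    · exact (pow_dvd_pow _ (Nat.sub_le _ _)).trans (pow_rootMultiplicity_dvd f x)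
  have hinter : S.card ≤ (T \ S).card + 1 := by
    refine Finset.card_le_sdiff_of_interleaved fun x hx y hy hxy _ => ?_
    obtain ⟨hx1, hxI⟩ := Finset.mem_filter.1 hx
    obtain ⟨hy1, hyI⟩ := Finset.mem_filter.1 hy
    rw [Multiset.mem_toFinset, mem_roots hf, IsRoot.def] at hx1 hy1
    have hsub : Set.Icc x y ⊆ Set.Ioo a b := fun z hz =>
      ⟨hxI.1.trans_le hz.1, hz.2.trans_lt hyI.2⟩
    have hpos : ∀ z ∈ Set.Icc x y, 0 < (w.eval z) ^ 2 := fun z hz => by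
      have := hw z (hsub hz); positivity
    -- Rolle for `f * (w ^ 2) ^ (-t / 2)`: squaring `w` first avoids a case split on its sign.
    obtain ⟨z, hz, hz0⟩ := exists_hasDerivAt_eq_zero
      (f := fun z => f.eval z * ((w.eval z) ^ 2) ^ (-t / 2))
      (f' := fun z => (derivative f).eval z * ((w.eval z) ^ 2) ^ (-t / 2)
        + f.eval z * ((2 * w.eval z * (derivative w).eval z) * (-t / 2)
          * ((w.eval z) ^ 2) ^ (-t / 2 - 1))) hxy
      (by
        refine f.continuous.continuousOn.mul
          (ContinuousOn.rpow_const (w.continuous.pow 2).continuousOn fun z hz =>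
            Or.inl (hpos z hz).ne'))
      (by
        rw [hx1, hy1, zero_mul, zero_mul])
      (fun z hz => by
        have h1 := (w.hasDerivAt z).pow 2
        have h2 := h1.rpow_const (p := -t / 2)
          (Or.inl (hpos z (Set.Ioo_subset_Icc_self hz)).ne')
        exact ((f.hasDerivAt z).mul h2).congr_deriv (by norm_num))
    have hzI := Set.Ioo_subset_Icc_self hz
    refine ⟨z, ?_, hz⟩
    rw [hT, Finset.mem_filter, Multiset.mem_toFinset, mem_roots hg]
    refine ⟨?_, hsub hzI⟩
    have e := congrArg (eval z) h
    simp only [eval_mul, eval_sub, eval_C] at e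
    have hp := hpos z hzI
    have hr : ((w.eval z) ^ 2) ^ (-t / 2)
        = ((w.eval z) ^ 2) ^ (-t / 2 - 1) * (w.eval z) ^ 2 := by
      rw [Real.rpow_sub_one hp.ne', div_mul_cancel₀ _ hp.ne']
    have hq : 0 < ((w.eval z) ^ 2) ^ (-t / 2 - 1) := Real.rpow_pos_of_pos hp _
    rw [hr] at hz0
    have h3 : ((w.eval z) ^ 2) ^ (-t / 2 - 1) * (w.eval z * (c.eval z * g.eval z)) = 0 := by
      rw [e, ← hz0]; ring
    have h4 := hw z (hsub hzI)
    have h5 := hc z (hsub hzI)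
    simpa [hq.ne', h4, h5] using h3
  rw [zeroCountOn_eq_sum, zeroCountOn_eq_sum, ← hS, ← hT]
  calc ∑ x ∈ S, f.rootMultiplicity x
      ≤ ∑ x ∈ S, (g.rootMultiplicity x + 1) := Finset.sum_le_sum hmult
    _ = ∑ x ∈ S, g.rootMultiplicity x + S.card := by
        rw [Finset.sum_add_distrib, Finset.card_eq_sum_ones]
    _ ≤ ∑ x ∈ S, g.rootMultiplicity x + ((T \ S).card + 1) := by gcongr
    _ ≤ ∑ x ∈ S, g.rootMultiplicity x + (∑ x ∈ T \ S, g.rootMultiplicity x + 1) := by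
        rw [Finset.card_eq_sum_ones]
        gcongr with x hx
        have := (Finset.mem_filter.1 (Finset.mem_sdiff.1 hx).1).1
        rw [Multiset.mem_toFinset, mem_roots hg] at this
        exact Nat.succ_le_of_lt ((rootMultiplicity_pos hg).2 this)
    _ = ∑ x ∈ S ∪ T, g.rootMultiplicity x + 1 := by
        rw [← add_assoc, ← Finset.sum_union Finset.disjoint_sdiff, Finset.union_sdiff_self_eq_union]
    _ = ∑ x ∈ T, g.rootMultiplicity x + 1 := by
        congr 1
        symm
        refine Finset.sum_subset Finset.subset_union_right fun x hx hxT => ?_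
        have hxI : x ∈ Set.Ioo a b := by
          rcases Finset.mem_union.1 hx with h | h
          · exact (Finset.mem_filter.1 h).2
          · exact (Finset.mem_filter.1 h).2
        rw [rootMultiplicity_eq_zero_iff]
        intro hr
        exact absurd (Finset.mem_filter.2 ⟨by rw [Multiset.mem_toFinset, mem_roots hg]; exact hr,
          hxI⟩) hxT

/-- Counting zeroes in `Ioo (u 0) (u d)` piece by piece. -/
theorem zeroCountOn_Ioo_eq_sum (f : ℝ[X]) (q : ℝ → Prop) (u : ℕ → ℝ) (d : ℕ) (hd : 1 ≤ d)
    (hu : ∀ k ∈ Finset.Icc 1 d, u (k - 1) < u k) :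
    zeroCountOn f {x | x ∈ Set.Ioo (u 0) (u d) ∧ q x}
      = ∑ k ∈ Finset.Icc 1 d, zeroCountOn f {x | x ∈ Set.Ioo (u (k - 1)) (u k) ∧ q x}
        + ∑ k ∈ Finset.Icc 1 (d - 1), zeroCountOn f {x | x = u k ∧ q x} := by
  induction d, hd using Nat.le_induction with
  | base => simp
  | succ d hd ih =>
    have ih' := ih fun k hk => hu k (by simp at hk ⊢; omega)
    have hlast : u d < u (d + 1) := by
      simpa using hu (d + 1) (by simp)
    have hfirst : u 0 < u d := by
      have : ∀ e, 1 ≤ e → e ≤ d → u 0 < u e := by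
        intro e he
        induction e, he using Nat.le_induction with
        | base => intro _; simpa using hu 1 (by simp)
        | succ e he ih2 =>
          intro h
          have := hu (e + 1) (by simp; omega)
          simp only [Nat.add_sub_cancel] at this
          exact (ih2 (by omega)).trans this
      exact this d hd le_rfl
    rw [Finset.sum_Icc_succ_top (by omega)]
    obtain ⟨d, rfl⟩ : ∃ e, d = e + 1 := ⟨d - 1, by omega⟩
    simp only [Nat.add_sub_cancel] at ih' ⊢
    rw [Finset.sum_Icc_succ_top (by omega) (fun k => zeroCountOn f {x | x = u k ∧ q x})]
    have hsplit : {x | x ∈ Set.Ioo (u 0) (u (d + 1 + 1)) ∧ q x}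
        = {x | x ∈ Set.Ioo (u 0) (u (d + 1)) ∧ q x} ∪ ({x | x = u (d + 1) ∧ q x} ∪
          {x | x ∈ Set.Ioo (u (d + 1)) (u (d + 1 + 1)) ∧ q x}) := by
      ext x
      simp only [Set.mem_Ioo, Set.mem_ofPred_eq, Set.mem_union]
      constructor
      · rintro ⟨⟨h1, h2⟩, h3⟩
        rcases lt_trichotomy x (u (d + 1)) with h | h | h
        · exact Or.inl ⟨⟨h1, h⟩, h3⟩
        · exact Or.inr (Or.inl ⟨h, h3⟩)
        · exact Or.inr (Or.inr ⟨⟨h, h2⟩, h3⟩)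
      · rintro (⟨⟨h1, h2⟩, h3⟩ | ⟨rfl, h3⟩ | ⟨⟨h1, h2⟩, h3⟩)
        · exact ⟨⟨h1, h2.trans hlast⟩, h3⟩
        · exact ⟨⟨hfirst, hlast⟩, h3⟩
        · exact ⟨⟨hfirst.trans h1, h2⟩, h3⟩
    rw [hsplit, zeroCountOn_union, zeroCountOn_union, ih']
    · ring
    · rw [Set.disjoint_left]
      rintro x ⟨rfl, -⟩ ⟨⟨h, -⟩, -⟩
      exact lt_irrefl _ h
    · rw [Set.disjoint_left]
      rintro x ⟨⟨-, h⟩, -⟩ (⟨rfl, -⟩ | ⟨⟨h', -⟩, -⟩)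
      · exact lt_irrefl _ h
      · exact lt_asymm h h'

/-! ### Laguerre's inequality and the logarithmic derivative. -/

theorem splits_derivative {p : ℝ[X]} (hp : p.Splits) : (derivative p).Splits := by
  rw [splits_iff_card_roots]
  have h1 := card_roots_le_derivative p
  rw [← hp.natDegree_eq_card_roots] at h1
  have h2 := natDegree_derivative_le p
  have h3 := card_roots' (derivative p)
  omega

/-- Off its zeroes, P P'' - P'² is P² (P'/P)', and P'/P is the sum of the 1/(x - r). Induction on
the roots avoids the quotients of polynomials. -/
theorem eval_laguerre_prod (s : Multiset ℝ) (x : ℝ) (hx : ∀ r ∈ s, x - r ≠ 0) :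
    ((s.map fun r => X - C r).prod.eval x
        * (derivative (derivative (s.map fun r => X - C r).prod)).eval x)
      - (derivative (s.map fun r => X - C r).prod).eval x ^ 2
      = - (s.map fun r => X - C r).prod.eval x ^ 2 * (s.map fun r => 1 / (x - r) ^ 2).sum := by
  induction s using Multiset.induction_on with
  | empty => simp
  | cons r s ih =>
    have h := ih fun r' hr' => hx r' (Multiset.mem_cons_of_mem hr')
    have hr := hx r (Multiset.mem_cons_self r s)
    simp only [Multiset.map_cons, Multiset.prod_cons, Multiset.sum_cons]
    generalize (s.map fun r => X - C r).prod = P at *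
    generalize (s.map fun r => 1 / (x - r) ^ 2).sum = S at *
    simp only [derivative_mul, derivative_sub, derivative_X, derivative_C, sub_zero, one_mul,
      derivative_add, eval_mul, eval_sub, eval_X, eval_C, eval_add]
    field_simp
    linear_combination (x - r) ^ 2 * h

theorem eval_laguerre_eq {p : ℝ[X]} (hp : p.Splits) {x : ℝ} (hx : p.eval x ≠ 0) :
    p.eval x * (derivative (derivative p)).eval x - (derivative p).eval x ^ 2
      = - p.eval x ^ 2 * (p.roots.map fun r => 1 / (x - r) ^ 2).sum := by
  have h := eval_laguerre_prod p.roots x fun r hr h0 => hx (by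
    rw [sub_eq_zero.1 h0]; exact isRoot_of_mem_roots hr)
  have e := hp.eq_prod_roots
  generalize (p.roots.map fun r => X - C r).prod = P at *
  generalize (p.roots.map fun r => 1 / (x - r) ^ 2).sum = S at *
  generalize p.leadingCoeff = c at *
  rw [e]
  simp only [derivative_mul, derivative_C, zero_mul, zero_add, eval_mul, eval_C]
  linear_combination c ^ 2 * h

theorem sum_map_roots_pos {p : ℝ[X]} (hp : p.Splits) (hd : 1 ≤ p.natDegree) {f : ℝ → ℝ}
    (hf : ∀ r ∈ p.roots, 0 < f r) : 0 < (p.roots.map f).sum := by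
  have hne : p.roots ≠ 0 := by
    intro h
    have := hp.natDegree_eq_card_roots
    rw [h, Multiset.card_zero] at this
    omega
  have hpos : ∀ y ∈ p.roots.map f, 0 < y := by
    intro y hy
    obtain ⟨r, hr, rfl⟩ := Multiset.mem_map.1 hy
    exact hf r hr
  obtain ⟨r, hr⟩ := Multiset.exists_mem_of_ne_zero hne
  have hm := Multiset.mem_map_of_mem f hr
  exact (hpos _ hm).trans_le (Multiset.single_le_sum (fun y hy => (hpos y hy).le) _ hm)

/-- Laguerre's inequality. -/
theorem eval_laguerre_neg {p : ℝ[X]} (hp : p.Splits) (hd : 1 ≤ p.natDegree) {x : ℝ}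
    (hx : p.eval x ≠ 0) :
    p.eval x * (derivative (derivative p)).eval x < (derivative p).eval x ^ 2 := by
  have h1 := eval_laguerre_eq hp hx
  have h2 : 0 < (p.roots.map fun r => 1 / (x - r) ^ 2).sum := sum_map_roots_pos hp hd fun r hr => by
    have : x - r ≠ 0 := fun h0 => hx (by rw [sub_eq_zero.1 h0]; exact isRoot_of_mem_roots hr)
    positivity
  have h3 : 0 < p.eval x ^ 2 := by positivity
  nlinarith [mul_pos h3 h2]

/-- The numerator of (p'/p)' is Laguerre's expression. Applied to p, this makes the critical point
between neighbouring zeroes unique; applied to p', it keeps zeroes of F from both sides of a simple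
zero. -/
theorem strictAntiOn_logDerivative {p : ℝ[X]} (hp : p.Splits) (hd : 1 ≤ p.natDegree) {s : Set ℝ}
    (hs : Convex ℝ s) (h0 : ∀ x ∈ s, p.eval x ≠ 0) :
    StrictAntiOn (fun x => (derivative p).eval x / p.eval x) s := by
  refine strictAntiOn_of_deriv_neg hs
    ((derivative p).continuous.continuousOn.div p.continuous.continuousOn h0) fun x hx => ?_
  have hx' := h0 x (interior_subset hx)
  have h1 : HasDerivAt (fun x => (derivative p).eval x / p.eval x) _ x :=
    ((derivative p).hasDerivAt x).div (p.hasDerivAt x) hx'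
  rw [h1.deriv]
  refine div_neg_of_neg_of_pos ?_ (by positivity)
  have := eval_laguerre_neg hp hd hx'
  nlinarith

/-! ### Local form, derivative identity and degree of F. -/

theorem eval_diffPoly (κ : ℝ) (p : ℝ[X]) (x : ℝ) :
    (diffPoly κ p).eval x = p.eval x * (derivative (derivative p)).eval x
      - κ * (derivative p).eval x ^ 2 := by
  simp [diffPoly]

theorem eval_diffPoly_neg_of_derivative_eq_zero {κ : ℝ} {p : ℝ[X]} (hp : p.Splits)
    (hd : 1 ≤ p.natDegree) {x : ℝ} (hx : p.eval x ≠ 0) (hx' : (derivative p).eval x = 0) :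
    (diffPoly κ p).eval x < 0 := by
  have := eval_laguerre_neg hp hd hx
  rw [eval_diffPoly, hx']
  rw [hx'] at this
  linarith

/-- The terms not divisible by p add up to (1 - 2κ + κκ') p'² p'', which the relation between κ and
κ' annihilates. The right side is the numerator of the derivative of F·|p'|^(-κ'). -/
theorem mul_diffPoly_derivative {κ κ' : ℝ} (h : κ * κ' = 2 * κ - 1) (p : ℝ[X]) :
    p * diffPoly κ' (derivative p) = derivative p * derivative (diffPoly κ p)
      - C κ' * derivative (derivative p) * diffPoly κ p := by
  have hC : C κ * C κ' = 2 * C κ - 1 := by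
    rw [← C_mul, h, C_sub, C_mul, C_1]; rfl
  simp only [diffPoly, derivative_sub, derivative_mul, derivative_C, derivative_pow, zero_mul,
    zero_add, Nat.cast_ofNat, Nat.add_one_sub_one, pow_one]
  rw [show (C 2 : ℝ[X]) = 2 from rfl]
  linear_combination (derivative p ^ 2 * derivative (derivative p)) * (-hC)

/-- For p = (X - x)^m q the constant is m q(x)². The removed power is even, so F and `g` have the
same sign away from x. -/
theorem exists_diffPoly_eq_pow_mul (κ : ℝ) {p : ℝ[X]} (hp : p ≠ 0) {x : ℝ} (hx : p.eval x = 0) :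
    ∃ g : ℝ[X], diffPoly κ p = (X - C x) ^ (2 * p.rootMultiplicity x - 2) * g ∧
      ∃ c : ℝ, 0 < c ∧
        g.eval x = c * (p.rootMultiplicity x - 1 - κ * p.rootMultiplicity x) := by
  obtain ⟨q, hq, hnd⟩ := exists_eq_pow_rootMultiplicity_mul_and_not_dvd p hp x
  have hpos : 0 < p.rootMultiplicity x := (rootMultiplicity_pos hp).2 hx
  have hqx : q.eval x ≠ 0 := fun h => hnd (dvd_iff_isRoot.2 h)
  generalize p.rootMultiplicity x = m at *
  subst hq
  have hX : derivative (X - C x) = 1 := by simp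
  match m, hpos with
  | 1, _ =>
    refine ⟨_, by simp only [mul_one, Nat.sub_self, pow_zero, one_mul]; rfl, q.eval x ^ 2,
      by positivity, ?_⟩
    rw [eval_diffPoly]
    simp [derivative_mul]
    ring
  | m + 2, _ =>
    refine ⟨q * (((m : ℝ[X]) + 2) * ((m : ℝ[X]) + 1) * q + 2 * ((m : ℝ[X]) + 2) * (X - C x) * derivative q
        + (X - C x) ^ 2 * derivative (derivative q))
      - C κ * (((m : ℝ[X]) + 2) * q + (X - C x) * derivative q) ^ 2, ?_, (m + 2) * q.eval x ^ 2,
      by positivity, ?_⟩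
    · have e : 2 * (m + 2) - 2 = 2 * m + 2 := by omega
      rw [e]
      simp only [diffPoly, derivative_mul, derivative_pow, hX, derivative_C, mul_one, Nat.cast_add, Nat.cast_ofNat, map_add, map_natCast]
      rw [show m + 2 - 1 = m + 1 by omega, show (C 2 : ℝ[X]) = 2 from rfl,
        show (derivative (m : ℝ[X])) = 0 from derivative_natCast]
      simp only [Nat.add_sub_cancel, Nat.cast_add, Nat.cast_one]
      ring
    · simp only [eval_sub, eval_mul, eval_add, eval_pow, eval_natCast, eval_ofNat, eval_one,
        eval_X, eval_C, sub_self]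
      push_cast
      ring

theorem natDegree_diffPoly_le (κ : ℝ) {p : ℝ[X]} {n : ℕ} (hn : p.natDegree = n) (h2 : 2 ≤ n) :
    (diffPoly κ p).natDegree ≤ 2 * n - 2 := by
  have h1 := natDegree_derivative_le p
  have h3 := natDegree_derivative_le (derivative p)
  unfold diffPoly
  refine (natDegree_sub_le _ _).trans (max_le ?_ ?_)
  · exact natDegree_mul_le.trans (by omega)
  · exact natDegree_mul_le.trans (by
      have := natDegree_pow_le (p := derivative p) (n := 2)
      rw [natDegree_C]; omega)

theorem coeff_diffPoly (κ : ℝ) {p : ℝ[X]} {n : ℕ} (hn : p.natDegree = n) (h2 : 2 ≤ n) :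
    (diffPoly κ p).coeff (2 * n - 2) = p.leadingCoeff ^ 2 * (n * (n - 1 - κ * n)) := by
  obtain ⟨m, rfl⟩ : ∃ m, n = m + 2 := ⟨n - 2, by omega⟩
  have h1 := natDegree_derivative_le p
  have h3 := natDegree_derivative_le (derivative p)
  rw [hn] at h1
  have e1 : (p * derivative (derivative p)).coeff ((m + 2) + m)
      = p.coeff (m + 2) * (derivative (derivative p)).coeff m :=
    coeff_mul_add_eq_of_natDegree_le hn.le (by omega)
  have e2 : (derivative p * derivative p).coeff ((m + 1) + (m + 1))
      = (derivative p).coeff (m + 1) * (derivative p).coeff (m + 1) :=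
    coeff_mul_add_eq_of_natDegree_le (by omega) (by omega)
  rw [diffPoly, coeff_sub, coeff_C_mul, pow_two, show 2 * (m + 2) - 2 = (m + 2) + m by omega, e1,
    show (m + 2) + m = (m + 1) + (m + 1) by omega, e2, coeff_derivative, coeff_derivative,
    leadingCoeff, hn]
  push_cast
  ring

theorem natDegree_diffPoly_eq {κ : ℝ} {p : ℝ[X]} {n : ℕ} (hn : p.natDegree = n) (h2 : 2 ≤ n)
    (hκ : (n : ℝ) - 1 - κ * n ≠ 0) : (diffPoly κ p).natDegree = 2 * n - 2 := by
  refine natDegree_eq_of_le_of_coeff_ne_zero (natDegree_diffPoly_le κ hn h2) ?_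
  rw [coeff_diffPoly κ hn h2]
  have : p.leadingCoeff ≠ 0 := by
    rw [leadingCoeff_ne_zero]; rintro rfl; simp at hn; omega
  have hn0 : (n : ℝ) ≠ 0 := by positivity
  positivity

theorem leadingCoeff_diffPoly_pos {κ : ℝ} {p : ℝ[X]} {n : ℕ} (hn : p.natDegree = n) (h2 : 2 ≤ n)
    (hκ : 0 < (n : ℝ) - 1 - κ * n) : 0 < (diffPoly κ p).leadingCoeff := by
  rw [leadingCoeff, natDegree_diffPoly_eq hn h2 hκ.ne', coeff_diffPoly κ hn h2]
  have : p.leadingCoeff ≠ 0 := by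
    rw [leadingCoeff_ne_zero]; rintro rfl; simp at hn; omega
  have hn0 : (0 : ℝ) < n := by positivity
  positivity

theorem eventually_eval_pos_of_even {f : ℝ[X]} (h : Even f.natDegree) (hl : 0 < f.leadingCoeff) :
    (∀ᶠ x in atBot, 0 < f.eval x) ∧ ∀ᶠ x in atTop, 0 < f.eval x := by
  have key : ∀ x : ℝ, x ≠ 0 → 0 < f.leadingCoeff * x ^ f.natDegree := fun x hx =>
    mul_pos hl (h.pow_pos hx)
  constructor
  · have h1 := f.isEquivalent_atBot_lead.symm
    obtain ⟨φ, hφ, he⟩ := h1.symm.exists_eq_mul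
    filter_upwards [he, hφ.eventually (lt_mem_nhds one_pos), eventually_lt_atBot 0] with x hx h0 hx0
    simp only [Pi.mul_apply] at hx
    rw [hx]
    exact mul_pos h0 (key x hx0.ne)
  · have h1 := f.isEquivalent_atTop_lead.symm
    obtain ⟨φ, hφ, he⟩ := h1.symm.exists_eq_mul
    filter_upwards [he, hφ.eventually (lt_mem_nhds one_pos), eventually_gt_atTop 0] with x hx h0 hx0
    simp only [Pi.mul_apply] at hx
    rw [hx]
    exact mul_pos h0 (key x hx0.ne')

/-! ### From non-real to real zeroes; interlacing with critical points. -/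

theorem nonrealZeroCount_add (f : ℝ[X]) :
    nonrealZeroCount f + Multiset.card f.roots = f.natDegree := by
  classical
  have h1 : Multiset.card (f.map (algebraMap ℝ ℂ)).roots = f.natDegree := by
    rw [← (IsAlgClosed.splits _).natDegree_eq_card_roots, natDegree_map]
  have h2 : (f.map (algebraMap ℝ ℂ)).roots.filter (fun z => ¬ z.im ≠ 0)
      = f.roots.map (algebraMap ℝ ℂ) := by
    ext z
    rw [Multiset.count_filter]
    by_cases hz : z.im = 0
    · rw [if_pos (not_not.2 hz)]
      obtain ⟨x, rfl⟩ : ∃ x : ℝ, algebraMap ℝ ℂ x = z := ⟨z.re, by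
        apply Complex.ext
        · simp
        · simpa using hz.symm⟩
      rw [Multiset.count_map_eq_count' _ _ (algebraMap ℝ ℂ).injective, count_roots, count_roots,
        eq_rootMultiplicity_map (algebraMap ℝ ℂ).injective]
    · rw [if_neg (not_not.2 hz)]
      symm
      rw [Multiset.count_eq_zero]
      intro h
      obtain ⟨x, -, rfl⟩ := Multiset.mem_map.1 h
      simp at hz
  have h3 := congrArg Multiset.card
    (Multiset.filter_add_not (fun z : ℂ => z.im ≠ 0) (f.map (algebraMap ℝ ℂ)).roots)
  rw [Multiset.card_add, h2, Multiset.card_map, h1] at h3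
  rw [← h3]
  unfold nonrealZeroCount
  congr!

theorem exists_strictMonoOn_image_eq (S : Finset ℝ) :
    ∃ u : ℕ → ℝ, StrictMonoOn u (Set.Icc 1 S.card) ∧ ∀ x, x ∈ S ↔ ∃ k ∈ Set.Icc 1 S.card, u k = x := by
  let e := S.orderEmbOfFin rfl
  refine ⟨fun k => if h : k - 1 < S.card then e ⟨k - 1, h⟩ else 0, ?_, ?_⟩
  · intro i hi j hj hij
    obtain ⟨h1, h2⟩ := hi
    obtain ⟨h3, h4⟩ := hj
    have hi' : i - 1 < S.card := by omega
    have hj' : j - 1 < S.card := by omega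
    simp only [hi', hj', dif_pos]
    apply e.strictMono
    simp only [Fin.mk_lt_mk]
    omega
  · intro x
    constructor
    · intro hx
      have : x ∈ Set.range e := by
        rw [Finset.range_orderEmbOfFin]; exact hx
      obtain ⟨i, rfl⟩ := this
      exact ⟨i + 1, ⟨by omega, by omega⟩, by simp⟩
    · rintro ⟨k, ⟨h1, h2⟩, rfl⟩
      have hk : k - 1 < S.card := by omega
      simp only [hk, dif_pos]
      exact S.orderEmbOfFin_mem rfl _

/-- `lam 1 < ⋯ < lam d` are zeroes of `p`, and `mu 1 < ⋯ < mu (d - 1)` are the zeroes of the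
derivative between them; no other zeroes of `p` or its derivative lie between `mu 0` and `mu d`. -/
structure Interlacing (p : ℝ[X]) (d : ℕ) (lam mu : ℕ → ℝ) : Prop where
  eval_lam : ∀ k, 1 ≤ k → k ≤ d → p.eval (lam k) = 0
  lt_lam : ∀ k, 1 ≤ k → k ≤ d → mu (k - 1) < lam k
  lam_lt : ∀ k, 1 ≤ k → k ≤ d → lam k < mu k
  eval_mu : ∀ k, 1 ≤ k → k ≤ d - 1 → p.eval (mu k) ≠ 0
  eval_derivative_mu : ∀ k, 1 ≤ k → k ≤ d - 1 → (derivative p).eval (mu k) = 0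
  eval_ne : ∀ k, 1 ≤ k → k ≤ d → ∀ x ∈ Set.Ioo (mu (k - 1)) (mu k), x ≠ lam k → p.eval x ≠ 0
  eval_derivative_ne : ∀ k, 1 ≤ k → k ≤ d → ∀ x ∈ Set.Ioo (mu (k - 1)) (mu k), x ≠ lam k →
    (derivative p).eval x ≠ 0

theorem eval_derivative_ne_zero_of_gt {p : ℝ[X]} (hp : p.Splits) (hd : 1 ≤ p.natDegree) {x : ℝ}
    (h : ∀ r, p.eval r = 0 → r < x) : (derivative p).eval x ≠ 0 := by
  have hx : p.eval x ≠ 0 := fun h0 => lt_irrefl _ (h x h0)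
  rw [hp.eval_derivative_eq_eval_mul_sum hx]
  refine mul_ne_zero hx (sum_map_roots_pos hp hd fun r hr => ?_).ne'
  have := h r (isRoot_of_mem_roots hr)
  exact one_div_pos.2 (by linarith)

theorem eval_derivative_ne_zero_of_lt {p : ℝ[X]} (hp : p.Splits) (hd : 1 ≤ p.natDegree) {x : ℝ}
    (h : ∀ r, p.eval r = 0 → x < r) : (derivative p).eval x ≠ 0 := by
  have hx : p.eval x ≠ 0 := fun h0 => lt_irrefl _ (h x h0)
  rw [hp.eval_derivative_eq_eval_mul_sum hx]
  have : 0 < (p.roots.map fun r => 1 / (r - x)).sum := sum_map_roots_pos hp hd fun r hr => by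
    have := h r (isRoot_of_mem_roots hr)
    exact one_div_pos.2 (by linarith)
  refine mul_ne_zero hx ?_
  rw [show (fun r => 1 / (x - r)) = fun r => - (1 / (r - x)) by
    ext r; rw [← neg_sub r x, one_div, one_div, inv_neg], Multiset.sum_map_neg]
  exact neg_ne_zero.2 this.ne'

theorem exists_interlacing {p : ℝ[X]} (hp : p.Splits) (hn : 1 ≤ p.natDegree) {d : ℕ}
    {lam : ℕ → ℝ} (hlam : StrictMonoOn lam (Set.Icc 1 d))
    (hroot : ∀ x, p.eval x = 0 ↔ ∃ k ∈ Set.Icc 1 d, lam k = x) {A B : ℝ} (hd : 1 ≤ d)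
    (hA : A < lam 1) (hB : lam d < B) :
    ∃ mu : ℕ → ℝ, mu 0 = A ∧ mu d = B ∧ Interlacing p d lam mu := by
  have hlamroot : ∀ k, 1 ≤ k → k ≤ d → p.eval (lam k) = 0 := fun k h1 h2 =>
    (hroot _).2 ⟨k, ⟨h1, h2⟩, rfl⟩
  have hlt : ∀ i j, 1 ≤ i → i < j → j ≤ d → lam i < lam j := fun i j h1 h2 h3 =>
    hlam ⟨h1, by omega⟩ ⟨by omega, h3⟩ h2
  have hle : ∀ i j, 1 ≤ i → i ≤ j → j ≤ d → lam i ≤ lam j := fun i j h1 h2 h3 =>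
    hlam.monotoneOn ⟨h1, by omega⟩ ⟨by omega, h3⟩ h2
  have hgap : ∀ k, 1 ≤ k → k + 1 ≤ d → ∀ x ∈ Set.Ioo (lam k) (lam (k + 1)), p.eval x ≠ 0 := by
    rintro k h1 h2 x ⟨hx1, hx2⟩ h0
    obtain ⟨i, ⟨hi1, hi2⟩, rfl⟩ := (hroot x).1 h0
    rcases le_or_gt i k with h | h
    · exact absurd (hle i k hi1 h (by omega)) (not_le.2 hx1)
    · exact absurd (hle (k + 1) i (by omega) h hi2) (not_le.2 hx2)
  have hrolle : ∀ k, ∃ x, 1 ≤ k → k + 1 ≤ d →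
      x ∈ Set.Ioo (lam k) (lam (k + 1)) ∧ (derivative p).eval x = 0 := by
    intro k
    by_cases h : 1 ≤ k ∧ k + 1 ≤ d
    · obtain ⟨x, hx, hx0⟩ := exists_hasDerivAt_eq_zero (f := fun x => p.eval x)
        (f' := fun x => (derivative p).eval x) (hlt k (k + 1) h.1 (by omega) h.2)
        p.continuous.continuousOn
        ((hlamroot k h.1 (by omega)).trans (hlamroot (k + 1) (by omega) h.2).symm)
        fun x _ => p.hasDerivAt x
      exact ⟨x, fun _ _ => ⟨hx, hx0⟩⟩
    · exact ⟨0, fun h1 h2 => absurd ⟨h1, h2⟩ h⟩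
  have huniq : ∀ k, 1 ≤ k → k + 1 ≤ d → ∀ x ∈ Set.Ioo (lam k) (lam (k + 1)),
      ∀ y ∈ Set.Ioo (lam k) (lam (k + 1)), (derivative p).eval x = 0 →
      (derivative p).eval y = 0 → x = y := by
    intro k h1 h2 x hx y hy hx0 hy0
    refine (strictAntiOn_logDerivative hp hn (convex_Ioo _ _) (hgap k h1 h2)).injOn hx hy ?_
    simp [hx0, hy0]
  choose m hm using hrolle
  -- Indices 0 and d carry the outer bounds `A` and `B`; only the indices between them are critical
  -- points.
  refine ⟨fun k => if k = 0 then A else if k = d then B else m k, by simp, by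
    simp [show d ≠ 0 by omega], ?_⟩
  have hl : ∀ k, 1 ≤ k → k ≤ d →
      (if k - 1 = 0 then A else if k - 1 = d then B else m (k - 1)) < lam k := by
    intro k h1 h2
    split_ifs with h3 h4
    · obtain rfl : k = 1 := by omega
      exact hA
    · omega
    · have := (hm (k - 1) (by omega) (by omega)).1.2
      rwa [show k - 1 + 1 = k by omega] at this
  have hr : ∀ k, 1 ≤ k → k ≤ d → lam k < (if k = 0 then A else if k = d then B else m k) := by
    intro k h1 h2
    split_ifs with h3 h4
    · omega
    · rw [h4]; exact hB
    · exact (hm k (by omega) (by omega)).1.1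
  refine ⟨hlamroot, hl, hr, ?_, ?_, ?_, ?_⟩
  · intro k h1 h2
    rw [if_neg (by omega), if_neg (by omega)]
    exact hgap k h1 (by omega) _ (hm k h1 (by omega)).1
  · intro k h1 h2
    rw [if_neg (by omega), if_neg (by omega)]
    exact (hm k h1 (by omega)).2
  · rintro k h1 h2 x ⟨hx1, hx2⟩ hne h0
    obtain ⟨i, ⟨hi1, hi2⟩, rfl⟩ := (hroot x).1 h0
    rcases lt_trichotomy i k with h | rfl | h
    · have h4 := hm (k - 1) (by omega) (by omega)
      rw [if_neg (by omega), if_neg (by omega)] at hx1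
      exact absurd (hle i (k - 1) hi1 (by omega) (by omega)) (not_le.2 (h4.1.1.trans hx1))
    · exact hne rfl
    · have h4 := hm k (by omega) (by omega)
      rw [if_neg (by omega), if_neg (by omega)] at hx2
      exact absurd (hle (k + 1) i (by omega) (by omega) (by omega)) (not_le.2 (hx2.trans h4.1.2))
  · rintro k h1 h2 x ⟨hx1, hx2⟩ hne h0
    rcases lt_or_gt_of_ne hne with h | h
    · by_cases hk : k = 1
      · subst hk
        refine eval_derivative_ne_zero_of_lt hp hn (fun r hr0 => ?_) h0
        obtain ⟨i, ⟨hi1, hi2⟩, rfl⟩ := (hroot r).1 hr0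
        exact h.trans_le (hle 1 i le_rfl hi1 hi2)
      · have h4 := hm (k - 1) (by omega) (by omega)
        rw [if_neg (by omega), if_neg (by omega)] at hx1
        have h5 := huniq (k - 1) (by omega) (by omega) _ h4.1 x ⟨h4.1.1.trans hx1, by
          rwa [show k - 1 + 1 = k by omega]⟩ h4.2 h0
        exact hx1.ne h5
    · by_cases hk : k = d
      · subst hk
        refine eval_derivative_ne_zero_of_gt hp hn (fun r hr0 => ?_) h0
        obtain ⟨i, ⟨hi1, hi2⟩, rfl⟩ := (hroot r).1 hr0
        exact (hle i k hi1 hi2 le_rfl).trans_lt h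
      · have h4 := hm k (by omega) (by omega)
        rw [if_neg (by omega), if_neg (by omega)] at hx2
        exact hx2.ne (huniq k (by omega) (by omega) x ⟨h, hx2.trans h4.1.2⟩ _ h4.1 h0 h4.2)

/-! ### Lower bounds for the number of real zeroes of F. -/

theorem zeroCountOn_pow_mul {f g : ℝ[X]} {x : ℝ} {e : ℕ} (hf : f ≠ 0)
    (h : f = (X - C x) ^ e * g) {s : Set ℝ} (hx : x ∈ s) :
    zeroCountOn f s = e + zeroCountOn g s := by
  subst h
  rw [zeroCountOn_mul hf, zeroCountOn_X_sub_C_pow hx]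

theorem zeroCountOn_pow_mul_of_notMem {f g : ℝ[X]} {x : ℝ} {e : ℕ} (hf : f ≠ 0)
    (h : f = (X - C x) ^ e * g) {s : Set ℝ} (hx : x ∉ s) :
    zeroCountOn f s = zeroCountOn g s := by
  subst h
  rw [zeroCountOn_mul hf, zeroCountOn_eq_zero (f := (X - C x) ^ e), zero_add]
  intro y hy
  have : y - x ≠ 0 := fun h => hx (by rwa [← sub_eq_zero.1 h])
  simpa using fun h => absurd h this

theorem eval_pow_mul_pos_iff {f g : ℝ[X]} {x : ℝ} {m : ℕ} (h : f = (X - C x) ^ (2 * m - 2) * g)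
    {y : ℝ} (hy : y ≠ x) : (0 < f.eval y ↔ 0 < g.eval y) ∧ (f.eval y < 0 ↔ g.eval y < 0) := by
  have hpos : 0 < (y - x) ^ (2 * m - 2) :=
    Even.pow_pos ⟨m - 1, by omega⟩ (sub_ne_zero.2 hy)
  subst h
  simp only [eval_mul, eval_pow, eval_sub, eval_X, eval_C]
  exact ⟨mul_pos_iff_of_pos_left hpos, by
    rw [← not_le, ← not_le, mul_nonneg_iff_of_pos_left hpos]⟩

theorem le_zeroCountOn_diffPoly {κ : ℝ} {p : ℝ[X]} (hp : p ≠ 0) (hF : diffPoly κ p ≠ 0) {a b x : ℝ}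
    (hx : x ∈ Set.Ioo a b) (h0 : p.eval x = 0) :
    2 * p.rootMultiplicity x ≤ zeroCountOn (diffPoly κ p) (Set.Ioo a b) + 2 := by
  obtain ⟨g, hg, -⟩ := exists_diffPoly_eq_pow_mul κ hp h0
  rw [zeroCountOn_pow_mul hF hg hx]
  omega

/-- A sign change makes the number of zeroes of the cofactor odd, which adds at least one to 2m - 2.
-/
theorem le_zeroCountOn_diffPoly_of_mul_neg {κ : ℝ} {p : ℝ[X]} (hp : p ≠ 0) {a b x : ℝ}
    (hx : x ∈ Set.Ioo a b) (h0 : p.eval x = 0)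
    (hab : 0 < (diffPoly κ p).eval a ∧ (diffPoly κ p).eval b < 0 ∨
      (diffPoly κ p).eval a < 0 ∧ 0 < (diffPoly κ p).eval b) :
    2 * p.rootMultiplicity x ≤ zeroCountOn (diffPoly κ p) (Set.Ioo a b) + 1 := by
  have hF : diffPoly κ p ≠ 0 := by
    intro h; rw [h] at hab; simp at hab
  obtain ⟨g, hg, -⟩ := exists_diffPoly_eq_pow_mul κ hp h0
  rw [zeroCountOn_pow_mul hF hg hx]
  have ha := eval_pow_mul_pos_iff hg hx.1.ne
  have hb := eval_pow_mul_pos_iff hg hx.2.ne'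
  rw [ha.1, ha.2, hb.1, hb.2] at hab
  have hneg : g.eval a * g.eval b < 0 := by
    rcases hab with h | h
    · exact mul_neg_of_pos_of_neg h.1 h.2
    · exact mul_neg_of_neg_of_pos h.1 h.2
  have hodd : ¬ Even (zeroCountOn g (Set.Ioo a b)) := by
    rw [even_zeroCountOn_Ioo_iff (hx.1.trans hx.2) (left_ne_zero_of_mul hneg.ne)
      (right_ne_zero_of_mul hneg.ne)]
    exact not_lt.2 hneg.le
  have : zeroCountOn g (Set.Ioo a b) ≠ 0 := fun h => hodd (by rw [h]; exact Even.zero)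
  omega

/-- The cofactor is negative at both ends and nonnegative at x, so it has a zero (possibly x
itself). Its number of zeroes is even, hence at least two. -/
theorem le_zeroCountOn_diffPoly_of_neg {κ : ℝ} {p : ℝ[X]} (hp : p ≠ 0) {a b x : ℝ}
    (hx : x ∈ Set.Ioo a b) (h0 : p.eval x = 0) (ha : (diffPoly κ p).eval a < 0)
    (hb : (diffPoly κ p).eval b < 0)
    (hκ : 0 ≤ (p.rootMultiplicity x : ℝ) - 1 - κ * p.rootMultiplicity x) :
    2 * p.rootMultiplicity x ≤ zeroCountOn (diffPoly κ p) (Set.Ioo a b) := by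
  have hF : diffPoly κ p ≠ 0 := by
    intro h; rw [h] at ha; simp at ha
  obtain ⟨g, hg, c, hc, hgx⟩ := exists_diffPoly_eq_pow_mul κ hp h0
  rw [zeroCountOn_pow_mul hF hg hx]
  rw [(eval_pow_mul_pos_iff hg hx.1.ne).2] at ha
  rw [(eval_pow_mul_pos_iff hg hx.2.ne').2] at hb
  have hgx0 : 0 ≤ g.eval x := by rw [hgx]; positivity
  have hg0 : g ≠ 0 := by
    intro h; rw [h] at ha; simp at ha
  obtain ⟨y, hy, hy0⟩ := intermediate_value_Icc hx.1.le g.continuous.continuousOn ⟨ha.le, hgx0⟩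
  have hya : a ≠ y := by
    rintro rfl
    exact ha.ne hy0
  have hpos := zeroCountOn_pos hg0 (s := Set.Ioo a b)
    ⟨lt_of_le_of_ne hy.1 hya, hy.2.trans_lt hx.2⟩ hy0
  have heven := (even_zeroCountOn_Ioo_iff (hx.1.trans hx.2) ha.ne hb.ne).2
    (mul_pos_of_neg_of_neg ha hb)
  obtain ⟨e, he⟩ := heven
  omega

theorem two_mul_sum_le_zeroCountOn_diffPoly {κ : ℝ} {p : ℝ[X]} (hp : p.Splits)
    (hn : 1 ≤ p.natDegree) {d : ℕ} (hd : 2 ≤ d) {lam mu : ℕ → ℝ} (h : Interlacing p d lam mu)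
    (h0 : 0 < (diffPoly κ p).eval (mu 0)) (h1 : 0 < (diffPoly κ p).eval (mu d)) :
    2 * ∑ k ∈ Finset.Icc 1 d, p.rootMultiplicity (lam k) ≤
      zeroCountOn (diffPoly κ p) Set.univ + 2 * ((Finset.Icc 2 (d - 1)).filter fun k =>
        (p.rootMultiplicity (lam k) : ℝ) - 1 - κ * p.rootMultiplicity (lam k) < 0).card + 2 := by
  have hp0 : p ≠ 0 := by rintro rfl; simp at hn
  have hF : diffPoly κ p ≠ 0 := by
    intro h; rw [h] at h0; simp at h0
  set F := diffPoly κ p with hFdef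
  set S := (Finset.Icc 2 (d - 1)).filter fun k =>
    (p.rootMultiplicity (lam k) : ℝ) - 1 - κ * p.rootMultiplicity (lam k) < 0 with hS
  have hmu : ∀ k, 1 ≤ k → k ≤ d - 1 → F.eval (mu k) < 0 := fun k hk1 hk2 =>
    eval_diffPoly_neg_of_derivative_eq_zero hp hn (h.eval_mu k hk1 hk2)
      (h.eval_derivative_mu k hk1 hk2)
  -- The deficit from 2m is 1 in each outer interval, where F changes sign, 2 at an interior zero in
  -- `S`, and 0 otherwise.
  have hloc : ∀ k ∈ Finset.Icc 1 d, 2 * p.rootMultiplicity (lam k) ≤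
      zeroCountOn F (Set.Ioo (mu (k - 1)) (mu k)) +
        ((if k = 1 then 1 else 0) + (if k = d then 1 else 0) + if k ∈ S then 2 else 0) := by
    intro k hk
    obtain ⟨hk1, hk2⟩ := Finset.mem_Icc.1 hk
    have hx : lam k ∈ Set.Ioo (mu (k - 1)) (mu k) := ⟨h.lt_lam k hk1 hk2, h.lam_lt k hk1 hk2⟩
    have he := h.eval_lam k hk1 hk2
    by_cases hk3 : k = 1
    · have := le_zeroCountOn_diffPoly_of_mul_neg hp0 hx he (κ := κ) (Or.inl ⟨by
        rw [hk3]; exact h0, hmu k hk1 (by omega)⟩)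
      rw [if_pos hk3]
      rw [← hFdef] at this
      omega
    by_cases hk4 : k = d
    · have := le_zeroCountOn_diffPoly_of_mul_neg hp0 hx he (κ := κ) (Or.inr
        ⟨hmu (k - 1) (by omega) (by omega), by rw [hk4]; exact h1⟩)
      rw [if_pos hk4]
      rw [← hFdef] at this
      omega
    by_cases hk5 : k ∈ S
    · have := le_zeroCountOn_diffPoly hp0 hF hx he
      rw [if_pos hk5]
      rw [← hFdef] at this
      omega
    · have hκ : 0 ≤ (p.rootMultiplicity (lam k) : ℝ) - 1 - κ * p.rootMultiplicity (lam k) := by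
        by_contra! hlt
        exact hk5 (Finset.mem_filter.2 ⟨Finset.mem_Icc.2 ⟨by omega, by omega⟩, hlt⟩)
      have := le_zeroCountOn_diffPoly_of_neg hp0 hx he (hmu (k - 1) (by omega) (by omega))
        (hmu k hk1 (by omega)) hκ
      rw [← hFdef] at this
      omega
  have hsum := Finset.sum_le_sum hloc
  rw [← Finset.mul_sum, Finset.sum_add_distrib, Finset.sum_add_distrib, Finset.sum_add_distrib,
    Finset.sum_ite_eq', Finset.sum_ite_eq', if_pos (Finset.mem_Icc.2 ⟨le_rfl, by omega⟩),
    if_pos (Finset.mem_Icc.2 ⟨by omega, le_rfl⟩), Finset.sum_ite_mem] at hsum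
  have hS2 : Finset.Icc 1 d ∩ S = S := Finset.inter_eq_right.2 fun k hk => by
    have := Finset.mem_Icc.1 (Finset.mem_filter.1 hk).1
    exact Finset.mem_Icc.2 ⟨by omega, by omega⟩
  rw [hS2, Finset.sum_const, smul_eq_mul] at hsum
  have htot := zeroCountOn_Ioo_eq_sum F (fun _ => True) mu d (by omega) fun k hk => by
    obtain ⟨hk1, hk2⟩ := Finset.mem_Icc.1 hk
    exact (h.lt_lam k hk1 hk2).trans (h.lam_lt k hk1 hk2)
  simp only [and_true] at htot
  have hmono := zeroCountOn_mono F (Set.subset_univ (Set.Ioo (mu 0) (mu d)))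
  have e : {x | x ∈ Set.Ioo (mu 0) (mu d)} = Set.Ioo (mu 0) (mu d) := rfl
  rw [e] at htot
  have e' : ∀ k, {x | x ∈ Set.Ioo (mu (k - 1)) (mu k)} = Set.Ioo (mu (k - 1)) (mu k) :=
    fun k => rfl
  simp only [e'] at htot
  omega

/-! ### Comparing the real zeroes of F_κ[p] and F_κ'[p']. -/

theorem zeroCountOn_le_of_forall_root {f : ℝ[X]} {s t : Set ℝ}
    (h : ∀ x ∈ s, f.eval x = 0 → x ∈ t) : zeroCountOn f s ≤ zeroCountOn f t := by
  classical
  refine Multiset.card_le_card (Multiset.le_filter.2 ⟨Multiset.filter_le _ _, fun x hx => ?_⟩)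
  obtain ⟨h1, h2⟩ := Multiset.mem_filter.1 hx
  exact h x h2 (isRoot_of_mem_roots h1)

theorem zeroCountOn_congr_of_forall_root {f : ℝ[X]} {s t : Set ℝ}
    (h : ∀ x, f.eval x = 0 → (x ∈ s ↔ x ∈ t)) : zeroCountOn f s = zeroCountOn f t :=
  le_antisymm (zeroCountOn_le_of_forall_root fun x hx h0 => (h x h0).1 hx)
    (zeroCountOn_le_of_forall_root fun x hx h0 => (h x h0).2 hx)

theorem natDegree_derivative_add_one {p : ℝ[X]} (h : 1 ≤ p.natDegree) :
    (derivative p).natDegree + 1 = p.natDegree := by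
  have := natDegree_eq_of_degree_eq_some (degree_derivative (p := p) (by omega))
  omega

/-- Next to x the sign of F is that of the cofactor at x, which is negative; so the sign at the
other end decides the parity. -/
theorem even_zeroCountOn_diffPoly_left {κ : ℝ} {p : ℝ[X]} (hp : p ≠ 0) {a x : ℝ} (hax : a < x)
    (h0 : p.eval x = 0) (hκ : (p.rootMultiplicity x : ℝ) - 1 - κ * p.rootMultiplicity x < 0)
    (ha : (diffPoly κ p).eval a ≠ 0) :
    Even (zeroCountOn (diffPoly κ p) (Set.Ioo a x)) ↔ (diffPoly κ p).eval a < 0 := by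
  obtain ⟨g, hg, c, hc, hgx⟩ := exists_diffPoly_eq_pow_mul κ hp h0
  have hF : diffPoly κ p ≠ 0 := by
    intro h; rw [h] at ha; simp at ha
  have hgx0 : g.eval x < 0 := by rw [hgx]; exact mul_neg_of_pos_of_neg hc hκ
  have hga : g.eval a ≠ 0 := by
    intro h; rw [hg, eval_mul, h, mul_zero] at ha; exact ha rfl
  rw [zeroCountOn_pow_mul_of_notMem hF hg (by simp), even_zeroCountOn_Ioo_iff hax hga hgx0.ne,
    (eval_pow_mul_pos_iff hg hax.ne).2]
  exact ⟨fun h => by by_contra! h'; nlinarith, fun h => mul_pos_of_neg_of_neg h hgx0⟩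

theorem even_zeroCountOn_diffPoly_right {κ : ℝ} {p : ℝ[X]} (hp : p ≠ 0) {b x : ℝ} (hxb : x < b)
    (h0 : p.eval x = 0) (hκ : (p.rootMultiplicity x : ℝ) - 1 - κ * p.rootMultiplicity x < 0)
    (hb : (diffPoly κ p).eval b ≠ 0) :
    Even (zeroCountOn (diffPoly κ p) (Set.Ioo x b)) ↔ (diffPoly κ p).eval b < 0 := by
  obtain ⟨g, hg, c, hc, hgx⟩ := exists_diffPoly_eq_pow_mul κ hp h0
  have hF : diffPoly κ p ≠ 0 := by
    intro h; rw [h] at hb; simp at hb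
  have hgx0 : g.eval x < 0 := by rw [hgx]; exact mul_neg_of_pos_of_neg hc hκ
  have hgb : g.eval b ≠ 0 := by
    intro h; rw [hg, eval_mul, h, mul_zero] at hb; exact hb rfl
  rw [zeroCountOn_pow_mul_of_notMem hF hg (by simp), even_zeroCountOn_Ioo_iff hxb hgx0.ne hgb,
    (eval_pow_mul_pos_iff hg hxb.ne').2]
  exact ⟨fun h => by by_contra! h'; nlinarith, fun h => mul_pos_of_neg_of_neg hgx0 h⟩

theorem eval_mul_eval_derivative_neg {p : ℝ[X]} {x y : ℝ} (hxy : x < y) (hy : p.eval y = 0)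
    (h : ∀ z ∈ Set.Ico x y, (derivative p).eval z ≠ 0) :
    p.eval x * (derivative p).eval x < 0 := by
  obtain ⟨z, hz, e⟩ := exists_hasDerivAt_eq_slope (fun x => p.eval x)
    (fun x => (derivative p).eval x) hxy p.continuous.continuousOn fun x _ => p.hasDerivAt x
  have hpos := eval_mul_eval_pos_of_ne_zero hz.1.le fun w hw => h w ⟨hw.1, hw.2.trans_lt hz.2⟩
  have hyx : 0 < y - x := sub_pos.2 hxy
  have e2 : p.eval x = -((derivative p).eval z * (y - x)) := by
    rw [e, hy]; field_simp; ring
  rw [e2]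
  nlinarith [mul_pos hpos hyx]

theorem eval_mul_eval_derivative_pos {p : ℝ[X]} {x y : ℝ} (hxy : y < x) (hy : p.eval y = 0)
    (h : ∀ z ∈ Set.Ioc y x, (derivative p).eval z ≠ 0) :
    0 < p.eval x * (derivative p).eval x := by
  obtain ⟨z, hz, e⟩ := exists_hasDerivAt_eq_slope (fun x => p.eval x)
    (fun x => (derivative p).eval x) hxy p.continuous.continuousOn fun x _ => p.hasDerivAt x
  have hpos := eval_mul_eval_pos_of_ne_zero hz.2.le fun w hw => h w ⟨hz.1.trans_le hw.1, hw.2⟩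
  have hyx : 0 < x - y := sub_pos.2 hxy
  have e2 : p.eval x = (derivative p).eval z * (x - y) := by
    rw [e, hy]; field_simp; ring
  rw [e2]
  nlinarith [mul_pos hpos hyx]

/-- Here x is a simple zero. At a zero of F, p p'' = κ p'² > 0, so p''/p' has the sign of p p':
negative left of x and positive right of it. As p''/p' decreases, zeroes of F lie on one side only,
and Rolle's loss of one occurs once. -/
theorem zeroCountOn_diffPoly_le_add_one {κ κ' : ℝ} (hκ : 0 < κ) (hκκ' : κ * κ' = 2 * κ - 1)
    {p : ℝ[X]} (hp : p.Splits) (hn : 2 ≤ p.natDegree) (hF₁ : diffPoly κ' (derivative p) ≠ 0)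
    {a b x : ℝ} (hx : x ∈ Set.Ioo a b) (h0 : p.eval x = 0)
    (hpne : ∀ y ∈ Set.Ioo a b, y ≠ x → p.eval y ≠ 0)
    (hdne : ∀ y ∈ Set.Ioo a b, (derivative p).eval y ≠ 0) :
    zeroCountOn (diffPoly κ p) (Set.Ioo a b)
      ≤ zeroCountOn (diffPoly κ' (derivative p)) (Set.Ioo a b) + 1 := by
  have hFx : (diffPoly κ p).eval x ≠ 0 := by
    rw [eval_diffPoly, h0, zero_mul, zero_sub]
    exact neg_ne_zero.2 (mul_ne_zero hκ.ne' (pow_ne_zero _ (hdne x hx)))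
  have hid := mul_diffPoly_derivative hκκ' p
  have hl : Set.Ioo a x ⊆ Set.Ioo a b := Set.Ioo_subset_Ioo_right hx.2.le
  have hr : Set.Ioo x b ⊆ Set.Ioo a b := Set.Ioo_subset_Ioo_left hx.1.le
  by_cases hL : ∃ y ∈ Set.Ioo a x, (diffPoly κ p).eval y = 0
  · by_cases hR : ∃ z ∈ Set.Ioo x b, (diffPoly κ p).eval z = 0
    · exfalso
      obtain ⟨y, hy, hy0⟩ := hL
      obtain ⟨z, hz, hz0⟩ := hR
      have h1 := eval_mul_eval_derivative_neg hy.2 h0 fun w hw =>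
        hdne w ⟨hy.1.trans_le hw.1, hw.2.trans hx.2⟩
      have h2 := eval_mul_eval_derivative_pos hz.1 h0 fun w hw =>
        hdne w ⟨hx.1.trans hw.1, hw.2.trans_lt hz.2⟩
      have hd1 : 1 ≤ (derivative p).natDegree := by
        have := natDegree_derivative_add_one (p := p) (by omega)
        omega
      have h3 := strictAntiOn_logDerivative (splits_derivative hp) hd1 (convex_Ioo a b) hdne
        (hl hy) (hr hz) (hy.2.trans hz.1)
      simp only at h3
      rw [eval_diffPoly] at hy0 hz0
      have hdy := hdne y (hl hy)
      have hdz := hdne z (hr hz)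
      have e : ∀ w, (derivative p).eval w ≠ 0 →
          p.eval w * (derivative (derivative p)).eval w - κ * (derivative p).eval w ^ 2 = 0 →
          (p.eval w * (derivative p).eval w) * ((derivative (derivative p)).eval w /
            (derivative p).eval w) = κ * (derivative p).eval w ^ 2 := by
        intro w hw hw0
        field_simp
        linear_combination hw0
      have ey := e y hdy hy0
      have ez := e z hdz hz0
      have py : 0 < κ * (derivative p).eval y ^ 2 := by positivity
      have pz : 0 < κ * (derivative p).eval z ^ 2 := by positivity
      rw [← ey] at py
      rw [← ez] at pz
      have q1 := neg_of_mul_pos_right py h1.le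
      have q2 := (mul_pos_iff_of_pos_left h2).1 pz
      linarith
    · push Not at hR
      calc _ ≤ zeroCountOn (diffPoly κ p) (Set.Ioo a x) :=
            zeroCountOn_le_of_forall_root fun y hy hy0 => by
              rcases lt_trichotomy y x with h | rfl | h
              · exact ⟨hy.1, h⟩
              · exact absurd hy0 hFx
              · exact absurd hy0 (hR y ⟨h, hy.2⟩)
        _ ≤ zeroCountOn (diffPoly κ' (derivative p)) (Set.Ioo a x) + 1 :=
            zeroCountOn_Ioo_le_of_mul_eq hF₁ hid (fun y hy => hpne y (hl hy) hy.2.ne)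
              fun y hy => hdne y (hl hy)
        _ ≤ _ := by gcongr; exact zeroCountOn_mono _ hl
  · push Not at hL
    calc _ ≤ zeroCountOn (diffPoly κ p) (Set.Ioo x b) :=
          zeroCountOn_le_of_forall_root fun y hy hy0 => by
            rcases lt_trichotomy y x with h | rfl | h
            · exact absurd hy0 (hL y ⟨hy.1, h⟩)
            · exact absurd hy0 hFx
            · exact ⟨h, hy.2⟩
      _ ≤ zeroCountOn (diffPoly κ' (derivative p)) (Set.Ioo x b) + 1 :=
          zeroCountOn_Ioo_le_of_mul_eq hF₁ hid (fun y hy => hpne y (hr hy) hy.1.ne')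
            fun y hy => hdne y (hr hy)
      _ ≤ _ := by gcongr; exact zeroCountOn_mono _ hr

/-- Rolle loses at most one zero: on each side of a multiple zero, or in total around a simple one.
The two counts compared have equal parity, as the end signs agree, so nothing is lost. -/
theorem zeroCountOn_diffPoly_le_derivative_Ioo {κ κ' : ℝ} (hκ : 0 < κ)
    (hκκ' : κ * κ' = 2 * κ - 1) {p : ℝ[X]} (hp : p.Splits) (hn : 2 ≤ p.natDegree) {a b x : ℝ}
    (hx : x ∈ Set.Ioo a b) (h0 : p.eval x = 0)
    (hm : (p.rootMultiplicity x : ℝ) - 1 - κ * p.rootMultiplicity x < 0)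
    (hm' : 1 < p.rootMultiplicity x → ((derivative p).rootMultiplicity x : ℝ) - 1
      - κ' * (derivative p).rootMultiplicity x < 0)
    (hpne : ∀ y ∈ Set.Ioo a b, y ≠ x → p.eval y ≠ 0)
    (hdne : ∀ y ∈ Set.Ioo a b, y ≠ x → (derivative p).eval y ≠ 0)
    (ha : 0 < (diffPoly κ p).eval a * (diffPoly κ' (derivative p)).eval a)
    (hb : 0 < (diffPoly κ p).eval b * (diffPoly κ' (derivative p)).eval b) :
    zeroCountOn (diffPoly κ p) {y | y ∈ Set.Ioo a b ∧ p.eval y ≠ 0} ≤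
      zeroCountOn (diffPoly κ' (derivative p))
        {y | y ∈ Set.Ioo a b ∧ (derivative p).eval y ≠ 0} := by
  have hp0 : p ≠ 0 := by rintro rfl; simp at hn
  have hFa := left_ne_zero_of_mul ha.ne'
  have hF₁a := right_ne_zero_of_mul ha.ne'
  have hFb := left_ne_zero_of_mul hb.ne'
  have hF₁b := right_ne_zero_of_mul hb.ne'
  have hF₁ : diffPoly κ' (derivative p) ≠ 0 := by
    intro h; rw [h] at hF₁a; simp at hF₁a
  have hd0 : derivative p ≠ 0 := by
    intro h
    have := natDegree_derivative_add_one (p := p) (by omega)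
    rw [h, natDegree_zero] at this
    omega
  have hl : Set.Ioo a x ⊆ Set.Ioo a b := Set.Ioo_subset_Ioo_right hx.2.le
  have hr : Set.Ioo x b ⊆ Set.Ioo a b := Set.Ioo_subset_Ioo_left hx.1.le
  have hdisj : Disjoint (Set.Ioo a x) (Set.Ioo x b) := by
    rw [Set.disjoint_left]
    intro y hy hy'
    exact lt_asymm hy.2 hy'.1
  have hset : ∀ q : ℝ[X], q.eval x = 0 → (∀ y ∈ Set.Ioo a b, y ≠ x → q.eval y ≠ 0) →
      {y | y ∈ Set.Ioo a b ∧ q.eval y ≠ 0} = Set.Ioo a x ∪ Set.Ioo x b := by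
    intro q hq0 hq
    ext y
    constructor
    · rintro ⟨hy, hy0⟩
      rcases lt_trichotomy y x with h | rfl | h
      · exact Or.inl ⟨hy.1, h⟩
      · exact absurd hq0 hy0
      · exact Or.inr ⟨h, hy.2⟩
    · rintro (hy | hy)
      · exact ⟨hl hy, hq y (hl hy) hy.2.ne⟩
      · exact ⟨hr hy, hq y (hr hy) hy.1.ne'⟩
  have hid := mul_diffPoly_derivative hκκ' p
  have hmd := derivative_rootMultiplicity_of_root (p := p) (t := x) h0
  by_cases h1 : 1 < p.rootMultiplicity x
  · have hd : (derivative p).eval x = 0 := by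
      have : 0 < (derivative p).rootMultiplicity x := by omega
      exact (rootMultiplicity_pos hd0).1 this
    rw [hset p h0 hpne, hset _ hd hdne, zeroCountOn_union _ hdisj, zeroCountOn_union _ hdisj]
    have r1 := zeroCountOn_Ioo_le_of_mul_eq hF₁ hid (fun y hy => hpne y (hl hy) hy.2.ne)
      fun y hy => hdne y (hl hy) hy.2.ne
    have r2 := zeroCountOn_Ioo_le_of_mul_eq hF₁ hid (fun y hy => hpne y (hr hy) hy.1.ne')
      fun y hy => hdne y (hr hy) hy.1.ne'
    have e1 := even_zeroCountOn_diffPoly_left hp0 hx.1 h0 hm hFa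
    have e1' := even_zeroCountOn_diffPoly_left hd0 hx.1 hd (hm' h1) hF₁a
    have e2 := even_zeroCountOn_diffPoly_right hp0 hx.2 h0 hm hFb
    have e2' := even_zeroCountOn_diffPoly_right hd0 hx.2 hd (hm' h1) hF₁b
    have s1 : (diffPoly κ p).eval a < 0 ↔ (diffPoly κ' (derivative p)).eval a < 0 :=
      ⟨fun h => neg_of_mul_pos_right ha h.le, fun h => neg_of_mul_pos_left ha h.le⟩
    have s2 : (diffPoly κ p).eval b < 0 ↔ (diffPoly κ' (derivative p)).eval b < 0 :=
      ⟨fun h => neg_of_mul_pos_right hb h.le, fun h => neg_of_mul_pos_left hb h.le⟩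
    rw [s1, ← e1', Nat.even_iff, Nat.even_iff] at e1
    rw [s2, ← e2', Nat.even_iff, Nat.even_iff] at e2
    omega
  · have hd : (derivative p).eval x ≠ 0 := by
      intro h
      have := (rootMultiplicity_pos hd0).2 h
      omega
    have hdne' : ∀ y ∈ Set.Ioo a b, (derivative p).eval y ≠ 0 := fun y hy => by
      by_cases h : y = x
      · rwa [h]
      · exact hdne y hy h
    have hset' : {y | y ∈ Set.Ioo a b ∧ (derivative p).eval y ≠ 0} = Set.Ioo a b := by
      ext y
      exact ⟨fun h => h.1, fun h => ⟨h, hdne' y h⟩⟩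
    rw [hset']
    have r := zeroCountOn_diffPoly_le_add_one hκ hκκ' hp hn hF₁ hx h0 hpne hdne'
    have r' := zeroCountOn_mono (diffPoly κ p)
      (show {y | y ∈ Set.Ioo a b ∧ p.eval y ≠ 0} ⊆ Set.Ioo a b from fun y hy => hy.1)
    have e := even_zeroCountOn_Ioo_iff (hx.1.trans hx.2) hFa hFb
    have e' := even_zeroCountOn_Ioo_iff (hx.1.trans hx.2) hF₁a hF₁b
    have s : 0 < (diffPoly κ p).eval a * (diffPoly κ p).eval b ↔
        0 < (diffPoly κ' (derivative p)).eval a * (diffPoly κ' (derivative p)).eval b := by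
      have : 0 < ((diffPoly κ p).eval a * (diffPoly κ p).eval b) *
        ((diffPoly κ' (derivative p)).eval a * (diffPoly κ' (derivative p)).eval b) := by
        nlinarith [mul_pos ha hb]
      exact ⟨fun h => (mul_pos_iff_of_pos_left h).1 this,
        fun h => (mul_pos_iff_of_pos_right h).1 this⟩
    rw [s, ← e', Nat.even_iff, Nat.even_iff] at e
    omega

theorem exists_forall_le_eval_diffPoly_pos {κ : ℝ} {p : ℝ[X]} {n : ℕ} (hn : p.natDegree = n)
    (h2 : 2 ≤ n) (hκ : 0 < (n : ℝ) - 1 - κ * n) :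
    (∃ A, ∀ x ≤ A, 0 < (diffPoly κ p).eval x) ∧ ∃ B, ∀ x, B ≤ x → 0 < (diffPoly κ p).eval x := by
  have hdeg := natDegree_diffPoly_eq hn h2 hκ.ne'
  have h := eventually_eval_pos_of_even (f := diffPoly κ p) (by rw [hdeg]; exact ⟨n - 1, by omega⟩)
    (leadingCoeff_diffPoly_pos hn h2 hκ)
  exact ⟨eventually_atBot.1 h.1, eventually_atTop.1 h.2⟩

theorem exists_interlacing_roots {p : ℝ[X]} (hp : p.Splits) (hn : 1 ≤ p.natDegree) (A B : ℝ) :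
    ∃ (d : ℕ) (lam mu : ℕ → ℝ), 1 ≤ d ∧ d ≤ p.natDegree ∧ mu 0 ≤ A ∧ B ≤ mu d ∧
      Interlacing p d lam mu ∧ ∀ x, p.eval x = 0 → ∃ k ∈ Set.Icc 1 d, lam k = x := by
  have hp0 : p ≠ 0 := by rintro rfl; simp at hn
  obtain ⟨lam, hlam, hmem⟩ := exists_strictMonoOn_image_eq p.roots.toFinset
  have hcard := hp.natDegree_eq_card_roots
  have hroot : ∀ x, p.eval x = 0 ↔ ∃ k ∈ Set.Icc 1 p.roots.toFinset.card, lam k = x := fun x => by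
    rw [← hmem, Multiset.mem_toFinset, mem_roots hp0, IsRoot.def]
  have hd : 1 ≤ p.roots.toFinset.card := by
    obtain ⟨r, hr⟩ := Multiset.card_pos_iff_exists_mem.1 (show 0 < Multiset.card p.roots by omega)
    exact Finset.card_pos.2 ⟨r, Multiset.mem_toFinset.2 hr⟩
  obtain ⟨mu, h0, h1, h⟩ := exists_interlacing hp hn hlam hroot (A := min A (lam 1 - 1))
    (B := max B (lam p.roots.toFinset.card + 1)) hd
    ((min_le_right _ _).trans_lt (by linarith)) (lt_of_lt_of_le (by linarith) (le_max_right _ _))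
  refine ⟨p.roots.toFinset.card, lam, mu, hd, ?_, ?_, ?_, h, fun x hx => (hroot x).1 hx⟩
  · rw [hcard]; exact Multiset.toFinset_card_le _
  · rw [h0]; exact min_le_left _ _
  · rw [h1]; exact le_max_left _ _

theorem Interlacing.mu_lt {p : ℝ[X]} {d : ℕ} {lam mu : ℕ → ℝ} (h : Interlacing p d lam mu) :
    ∀ k ∈ Finset.Icc 1 d, mu (k - 1) < mu k := fun k hk => by
  obtain ⟨hk1, hk2⟩ := Finset.mem_Icc.1 hk
  exact (h.lt_lam k hk1 hk2).trans (h.lam_lt k hk1 hk2)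

theorem Interlacing.zeroCountOn_diffPoly_eq {κ : ℝ} {p : ℝ[X]} (hp : p.Splits)
    (hn : 1 ≤ p.natDegree) {d : ℕ} (hd : 1 ≤ d) {lam mu : ℕ → ℝ} (h : Interlacing p d lam mu)
    (hA : ∀ x ≤ mu 0, 0 < (diffPoly κ p).eval x)
    (hB : ∀ x, mu d ≤ x → 0 < (diffPoly κ p).eval x) :
    zeroCountOn (diffPoly κ p) {x | p.eval x ≠ 0} = ∑ k ∈ Finset.Icc 1 d,
      zeroCountOn (diffPoly κ p) {x | x ∈ Set.Ioo (mu (k - 1)) (mu k) ∧ p.eval x ≠ 0} := by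
  have e := zeroCountOn_Ioo_eq_sum (diffPoly κ p) (fun x => p.eval x ≠ 0) mu d hd h.mu_lt
  rw [Finset.sum_eq_zero (s := Finset.Icc 1 (d - 1)), add_zero] at e
  · rw [← e]
    refine zeroCountOn_congr_of_forall_root fun x hx => ⟨fun hx0 => ⟨⟨?_, ?_⟩, hx0⟩, fun h => h.2⟩
    · by_contra! hle
      exact (hA x hle).ne' hx
    · by_contra! hle
      exact (hB x hle).ne' hx
  · intro k hk
    obtain ⟨hk1, hk2⟩ := Finset.mem_Icc.1 hk
    refine zeroCountOn_eq_zero ?_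
    rintro x ⟨rfl, -⟩
    exact (eval_diffPoly_neg_of_derivative_eq_zero hp hn (h.eval_mu k hk1 hk2)
      (h.eval_derivative_mu k hk1 hk2)).ne

/-- The number of zeroes of `diffPoly κ p` off the zeroes of `p` does not decrease if `p` is
replaced by its derivative and `κ` by `2 - 1 / κ`. -/
theorem zeroCountOn_diffPoly_le_derivative {κ κ' : ℝ} (hκ : 0 < κ) (hκ' : 0 < κ')
    (hκκ' : κ * κ' = 2 * κ - 1) {p : ℝ[X]} (hp : p.Splits) {n : ℕ} (hn : p.natDegree = n)
    (h3 : 3 ≤ n) (hκn : 0 < (n : ℝ) - 1 - κ * n)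
    (hκn' : 0 < ((n - 1 : ℕ) : ℝ) - 1 - κ' * (n - 1 : ℕ))
    (hm : ∀ x, p.eval x = 0 → (p.rootMultiplicity x : ℝ) - 1 - κ * p.rootMultiplicity x < 0)
    (hm' : ∀ x, 1 < p.rootMultiplicity x → ((derivative p).rootMultiplicity x : ℝ) - 1
      - κ' * (derivative p).rootMultiplicity x < 0) :
    zeroCountOn (diffPoly κ p) {x | p.eval x ≠ 0} ≤
      zeroCountOn (diffPoly κ' (derivative p)) {x | (derivative p).eval x ≠ 0} := by
  have hn' : (derivative p).natDegree = n - 1 := by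
    have := natDegree_derivative_add_one (p := p) (by omega)
    omega
  obtain ⟨⟨A, hA⟩, B, hB⟩ := exists_forall_le_eval_diffPoly_pos hn (by omega) hκn
  obtain ⟨⟨A', hA'⟩, B', hB'⟩ := exists_forall_le_eval_diffPoly_pos hn' (by omega) hκn'
  obtain ⟨d, lam, mu, hd, -, h0, h1, h, -⟩ :=
    exists_interlacing_roots hp (by omega) (min A A') (max B B')
  rw [le_min_iff] at h0
  rw [max_le_iff] at h1
  rw [h.zeroCountOn_diffPoly_eq hp (by omega) hd (fun x hx => hA x (hx.trans h0.1))
    fun x hx => hB x (h1.1.trans hx)]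
  have e := zeroCountOn_Ioo_eq_sum (diffPoly κ' (derivative p))
    (fun x => (derivative p).eval x ≠ 0) mu d hd h.mu_lt
  have hmono := zeroCountOn_mono (diffPoly κ' (derivative p))
    (show {x | x ∈ Set.Ioo (mu 0) (mu d) ∧ (derivative p).eval x ≠ 0} ⊆
      {x | (derivative p).eval x ≠ 0} from fun x hx => hx.2)
  refine le_trans ?_ hmono
  rw [e]
  refine le_trans (Finset.sum_le_sum fun k hk => ?_) (Nat.le_add_right _ _)
  obtain ⟨hk1, hk2⟩ := Finset.mem_Icc.1 hk
  -- At an inner critical point both values are negative: p p'' by Laguerre, and -κ' p''² because κ'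
  -- > 0. At the two outer points both are positive.
  have hmu : ∀ i, i ≤ d → 0 < (diffPoly κ p).eval (mu i) *
      (diffPoly κ' (derivative p)).eval (mu i) := by
    intro i hi
    by_cases hi0 : i = 0
    · subst hi0
      exact mul_pos (hA _ h0.1) (hA' _ h0.2)
    by_cases hid : i = d
    · subst hid
      exact mul_pos (hB _ h1.1) (hB' _ h1.2)
    have hc := h.eval_derivative_mu i (by omega) (by omega)
    have hl := eval_laguerre_neg hp (by omega) (h.eval_mu i (by omega) (by omega))
    refine mul_pos_of_neg_of_neg (eval_diffPoly_neg_of_derivative_eq_zero hp (by omega)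
      (h.eval_mu i (by omega) (by omega)) hc) ?_
    rw [eval_diffPoly, hc]
    have : (derivative (derivative p)).eval (mu i) ≠ 0 := by
      intro h'; rw [h', hc] at hl; simp at hl
    have : 0 < κ' * (derivative (derivative p)).eval (mu i) ^ 2 := by positivity
    linarith
  have hroot := h.eval_lam k hk1 hk2
  exact zeroCountOn_diffPoly_le_derivative_Ioo hκ hκκ' hp (by omega)
    ⟨h.lt_lam k hk1 hk2, h.lam_lt k hk1 hk2⟩ hroot (hm _ hroot) (hm' _)
    (h.eval_ne k hk1 hk2) (h.eval_derivative_ne k hk1 hk2) (hmu (k - 1) (by omega)) (hmu k hk2)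

/-! ### Induction on the degree through successive derivatives. -/

theorem zeroCountOn_le_natDegree (f : ℝ[X]) (s : Set ℝ) : zeroCountOn f s ≤ f.natDegree :=
  (zeroCountOn_mono f (Set.subset_univ s)).trans (by rw [zeroCountOn_univ]; exact card_roots' f)

/-- The case `κ = 1 / 2` for a polynomial with simple zeroes only. -/
theorem zeroCountOn_diffPoly_half_le {p : ℝ[X]} (hp : p.Splits) {n : ℕ} (hn : p.natDegree = n)
    (h3 : 3 ≤ n) (hm : ∀ x, p.rootMultiplicity x ≤ 1) :
    zeroCountOn (diffPoly (1 / 2) p) {x | p.eval x ≠ 0} ≤ 2 * (n - 2) := by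
  have hp0 : p ≠ 0 := by rintro rfl; simp at hn; omega
  have hn1 := natDegree_derivative_add_one (p := p) (by omega)
  have hn2 := natDegree_derivative_add_one (p := derivative p) (by omega)
  have hn3 := natDegree_derivative_add_one (p := derivative (derivative p)) (by omega)
  have hd0 : derivative p ≠ 0 := by intro h; rw [h] at hn1; simp at hn1; omega
  have hddd0 : derivative (derivative (derivative p)) ≠ 0 := by
    intro h
    have := derivative_eq_zero.1 h
    omega
  have hF₁ : diffPoly 0 (derivative p) = derivative p * derivative (derivative (derivative p)) := by
    simp [diffPoly]
  have hF₁0 : diffPoly 0 (derivative p) ≠ 0 := by rw [hF₁]; exact mul_ne_zero hd0 hddd0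
  have hnR : (3 : ℝ) ≤ n := by exact_mod_cast h3
  obtain ⟨⟨A, hA⟩, B, hB⟩ := exists_forall_le_eval_diffPoly_pos (κ := 1 / 2) hn (by omega)
    (by linarith)
  obtain ⟨d, lam, mu, hd, hdn, h0, h1, h, hroot⟩ := exists_interlacing_roots hp (by omega) A B
  have hA' : ∀ x ≤ mu 0, 0 < (diffPoly (1 / 2) p).eval x := fun x hx => hA x (hx.trans h0)
  have hB' : ∀ x, mu d ≤ x → 0 < (diffPoly (1 / 2) p).eval x := fun x hx => hB x (h1.trans hx)
  have hdlam : ∀ x, p.eval x = 0 → (derivative p).eval x ≠ 0 := fun x hx h' => by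
    have := (one_lt_rootMultiplicity_iff_isRoot hp0).2 ⟨hx, h'⟩
    exact absurd (hm x) (not_le.2 this)
  have hlt : mu 0 < mu d := by
    have h2 : ∀ k, k ≤ d → mu 0 ≤ mu k := by
      intro k
      induction k with
      | zero => intro _; exact le_rfl
      | succ k ih =>
        intro hk
        exact (ih (by omega)).trans (h.mu_lt (k + 1) (Finset.mem_Icc.2 ⟨by omega, hk⟩)).le
    have := h.mu_lt d (Finset.mem_Icc.2 ⟨hd, le_rfl⟩)
    exact (h2 (d - 1) (by omega)).trans_lt this
  have heven : Even (zeroCountOn (diffPoly (1 / 2) p) {x | p.eval x ≠ 0}) := by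
    rw [zeroCountOn_congr_of_forall_root (t := Set.Ioo (mu 0) (mu d)),
      even_zeroCountOn_Ioo_iff hlt (hA' _ le_rfl).ne' (hB' _ le_rfl).ne']
    · exact mul_pos (hA' _ le_rfl) (hB' _ le_rfl)
    · intro x hx
      constructor
      · intro _
        constructor
        · by_contra! hle
          exact (hA' x hle).ne' hx
        · by_contra! hle
          exact (hB' x hle).ne' hx
      · intro _ hx0
        rw [eval_diffPoly, hx0, zero_mul, zero_sub] at hx
        exact neg_ne_zero.2 (mul_ne_zero (by norm_num) (pow_ne_zero 2 (hdlam x hx0))) hx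
  have hsum := h.zeroCountOn_diffPoly_eq hp (by omega) hd hA' hB'
  -- Now κ' = 0 and F_0[p'] = p' p''' vanishes at the critical points, so parity is unavailable
  -- interval by interval. The loss of one per interval is kept.
  have hloc : ∀ k ∈ Finset.Icc 1 d,
      zeroCountOn (diffPoly (1 / 2) p) {x | x ∈ Set.Ioo (mu (k - 1)) (mu k) ∧ p.eval x ≠ 0} ≤
      zeroCountOn (derivative (derivative (derivative p)))
        {x | x ∈ Set.Ioo (mu (k - 1)) (mu k) ∧ True} + 1 := by
    intro k hk
    obtain ⟨hk1, hk2⟩ := Finset.mem_Icc.1 hk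
    have hr := h.eval_lam k hk1 hk2
    have hdne : ∀ y ∈ Set.Ioo (mu (k - 1)) (mu k), (derivative p).eval y ≠ 0 := fun y hy => by
      by_cases hyx : y = lam k
      · rw [hyx]; exact hdlam _ hr
      · exact h.eval_derivative_ne k hk1 hk2 y hy hyx
    have := zeroCountOn_diffPoly_le_add_one (κ := 1 / 2) (κ' := 0) (by norm_num) (by norm_num) hp
      (by omega) hF₁0 ⟨h.lt_lam k hk1 hk2, h.lam_lt k hk1 hk2⟩ hr (h.eval_ne k hk1 hk2) hdne
    rw [hF₁, zeroCountOn_mul (mul_ne_zero hd0 hddd0), zeroCountOn_eq_zero hdne, zero_add] at this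
    simp only [and_true]
    exact (zeroCountOn_mono _ fun y hy => hy.1).trans this
  have e := zeroCountOn_Ioo_eq_sum (derivative (derivative (derivative p))) (fun _ => True) mu d hd
    h.mu_lt
  have hle := zeroCountOn_le_natDegree (derivative (derivative (derivative p)))
    {x | x ∈ Set.Ioo (mu 0) (mu d) ∧ True}
  have hs := Finset.sum_le_sum hloc
  rw [Finset.sum_add_distrib, Finset.sum_const, Nat.card_Icc, smul_eq_mul, mul_one] at hs
  -- The total is at most (n - 3) + d ≤ 2n - 3; being even, it is at most 2n - 4.
  obtain ⟨r, hr⟩ := heven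
  omega

/-- With κ = 1 - 1/ν, passing to p' lowers both degree and ν by one, so their difference persists.
The condition m - 1 - κm < 0 reads m < ν and is inherited by p'. -/
theorem zeroCountOn_diffPoly_le_of_sub_le (j : ℕ) {n : ℕ} : ∀ {p : ℝ[X]} {ν : ℝ}, p.Splits →
    p.natDegree = n → 1 < ν → ν < n → (n : ℝ) - ν ≤ j → (∀ x, (p.rootMultiplicity x : ℝ) < ν) →
    zeroCountOn (diffPoly (1 - 1 / ν) p) {x | p.eval x ≠ 0} ≤ 2 * j := by
  induction n with
  | zero => intro p ν _ _ h1 h2; norm_num at h2; linarith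
  | succ n ih =>
    intro p ν hp hn h1 h2 hj hm
    push_cast at h2 hj
    have hnpos : 1 ≤ n := by
      have : (0 : ℝ) < n := by linarith
      exact_mod_cast this
    rcases lt_trichotomy ν 2 with hν | rfl | hν
    -- For ν < 2 the next κ' would be negative, but the degree bound on F already suffices; the
    -- degree of p is `n + 1` here.
    · have : (n : ℝ) < j + 1 := by linarith
      have : n < j + 1 := by exact_mod_cast this
      have h3 := zeroCountOn_le_natDegree (diffPoly (1 - 1 / ν) p) {x | p.eval x ≠ 0}
      have h4 := natDegree_diffPoly_le (1 - 1 / ν) hn (by omega)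
      omega
    · have h3 : (1 : ℝ) < n := by linarith
      have h3 : 1 < n := by exact_mod_cast h3
      have h4 : (n : ℝ) ≤ j + 1 := by linarith
      have h4 : n ≤ j + 1 := by exact_mod_cast h4
      have h5 := zeroCountOn_diffPoly_half_le hp hn (by omega) fun x => by
        have : (p.rootMultiplicity x) < 2 := by exact_mod_cast hm x
        omega
      rw [show (1 : ℝ) - 1 / 2 = 1 / 2 by norm_num]
      omega
    · have h3 : (1 : ℝ) < n := by linarith
      have h3 : 1 < n := by exact_mod_cast h3
      have hn' := natDegree_derivative_add_one (p := p) (by omega)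
      have hd0 : derivative p ≠ 0 := by intro h; rw [h] at hn'; simp at hn'; omega
      have hν0 : ν ≠ 0 := by linarith
      have hν1 : ν - 1 ≠ 0 := by linarith
      have hp0 : p ≠ 0 := by rintro rfl; simp at hn
      -- A zero of p' that is not a zero of p is simple by Laguerre, and 1 < ν - 1.
      have hmd : ∀ x, ((derivative p).rootMultiplicity x : ℝ) < ν - 1 := by
        intro x
        by_cases hx : p.eval x = 0
        · have e := derivative_rootMultiplicity_of_root (p := p) (t := x) hx
          have hpos := (rootMultiplicity_pos hp0).2 hx
          have e' : (derivative p).rootMultiplicity x + 1 = p.rootMultiplicity x := by omega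
          have e'' : ((derivative p).rootMultiplicity x : ℝ) + 1 = p.rootMultiplicity x := by
            exact_mod_cast e'
          have := hm x
          linarith
        · have : (derivative p).rootMultiplicity x ≤ 1 := by
            by_contra! hlt
            obtain ⟨h5, h6⟩ := (one_lt_rootMultiplicity_iff_isRoot hd0).1 hlt
            have := eval_laguerre_neg hp (by omega) hx
            rw [IsRoot.def] at h5 h6
            rw [h5, h6] at this
            simp at this
          have : ((derivative p).rootMultiplicity x : ℝ) ≤ 1 := by exact_mod_cast this
          linarith
      have hmult : ∀ (μ : ℝ) (m : ℕ), 1 < μ → (m : ℝ) < μ → (m : ℝ) - 1 - (1 - 1 / μ) * m < 0 := by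
        intro μ m hμ hmμ
        have : (m : ℝ) - 1 - (1 - 1 / μ) * m = m / μ - 1 := by ring
        rw [this, sub_neg, div_lt_one (by linarith)]
        exact hmμ
      have hmultpos : ∀ (μ : ℝ) (m : ℕ), 1 < μ → μ < m → 0 < (m : ℝ) - 1 - (1 - 1 / μ) * m := by
        intro μ m hμ hmμ
        have : (m : ℝ) - 1 - (1 - 1 / μ) * m = m / μ - 1 := by ring
        rw [this, sub_pos, one_lt_div (by linarith)]
        exact hmμ
      have hκpos : ∀ μ : ℝ, 1 < μ → 0 < 1 - 1 / μ := fun μ hμ => by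
        rw [sub_pos, div_lt_one (by linarith)]
        exact hμ
      refine le_trans (zeroCountOn_diffPoly_le_derivative (κ' := 1 - 1 / (ν - 1)) (hκpos ν h1)
        (hκpos _ (by linarith)) (by field_simp; ring) hp hn (by omega)
        (hmultpos _ _ h1 (by push_cast; linarith)) (hmultpos _ _ (by linarith) (by
          rw [Nat.add_sub_cancel]; linarith)) (fun x _ => hmult _ _ h1 (hm x))
        (fun x _ => hmult _ _ (by linarith) (hmd x))) ?_
      exact ih (splits_derivative hp) (by omega) (by linarith) (by linarith) (by linarith) hmd

/-! ### The variance form and large κ. -/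

theorem sum_roots_eq (p : ℝ[X]) (f : ℝ → ℝ) :
    (p.roots.map f).sum = ∑ r ∈ p.roots.toFinset, (p.rootMultiplicity r : ℝ) * f r := by
  rw [Finset.sum_multiset_map_count]
  simp

/-- Lagrange's identity, the equality behind Cauchy–Schwarz; it turns n∑m a² - (∑m a)² into a sum of
squares. -/
theorem sum_mul_sum_sq_sub_sq_sum (s : Finset ℝ) (w a : ℝ → ℝ) :
    (∑ r ∈ s, w r) * (∑ r ∈ s, w r * a r ^ 2) - (∑ r ∈ s, w r * a r) ^ 2
      = (∑ r ∈ s, ∑ t ∈ s, w r * w t * (a r - a t) ^ 2) / 2 := by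
  have h1 : ∑ r ∈ s, ∑ t ∈ s, w r * w t * (a r - a t) ^ 2
      = (∑ r ∈ s, ∑ t ∈ s, (w r * a r ^ 2) * w t) + (∑ r ∈ s, ∑ t ∈ s, w r * (w t * a t ^ 2))
        - 2 * ∑ r ∈ s, ∑ t ∈ s, (w r * a r) * (w t * a t) := by
    simp only [Finset.mul_sum, ← Finset.sum_add_distrib, ← Finset.sum_sub_distrib]
    exact Finset.sum_congr rfl fun r _ => Finset.sum_congr rfl fun t _ => by ring
  rw [h1, ← Finset.sum_mul_sum, ← Finset.sum_mul_sum, ← Finset.sum_mul_sum]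
  ring

theorem sum_rootMultiplicity {p : ℝ[X]} (hp : p.Splits) :
    ∑ r ∈ p.roots.toFinset, p.rootMultiplicity r = p.natDegree := by
  rw [hp.natDegree_eq_card_roots, ← Multiset.toFinset_sum_count_eq]
  simp

/-- The variance form of `diffPoly κ p` off the zeroes of `p`. -/
theorem natDegree_mul_eval_diffPoly {κ : ℝ} {p : ℝ[X]} (hp : p.Splits) {x : ℝ}
    (hx : p.eval x ≠ 0) :
    p.natDegree * (diffPoly κ p).eval x = p.eval x ^ 2 *
      ((1 - κ) * p.natDegree - 1) * (p.roots.map fun r => 1 / (x - r)).sum ^ 2 - p.eval x ^ 2 *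
        ((∑ r ∈ p.roots.toFinset, ∑ t ∈ p.roots.toFinset, (p.rootMultiplicity r : ℝ) *
          p.rootMultiplicity t * (1 / (x - r) - 1 / (x - t)) ^ 2) / 2) := by
  -- With S₁ and S₂ the weighted sums of 1/(x - r) and of its square, F/p² = (1 - κ)S₁² - S₂.
  have h1 := eval_laguerre_eq hp hx
  have h2 := hp.eval_derivative_eq_eval_mul_sum hx
  rw [← sum_mul_sum_sq_sub_sq_sum _ (fun r => (p.rootMultiplicity r : ℝ)) (fun r => 1 / (x - r)),
    ← Nat.cast_sum, sum_rootMultiplicity hp, ← sum_roots_eq p fun r => 1 / (x - r),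
    eval_diffPoly]
  have h3 : (p.roots.map fun r => 1 / (x - r) ^ 2).sum
      = ∑ r ∈ p.roots.toFinset, (p.rootMultiplicity r : ℝ) * (1 / (x - r)) ^ 2 := by
    rw [sum_roots_eq]
    simp only [div_pow, one_pow]
  rw [h3] at h1
  rw [h2] at h1 ⊢
  linear_combination (p.natDegree : ℝ) * h1

theorem sum_sum_pos {p : ℝ[X]} (hp0 : p ≠ 0) (hcard : 2 ≤ p.roots.toFinset.card) {a : ℝ → ℝ}
    (ha : ∀ r ∈ p.roots.toFinset, ∀ t ∈ p.roots.toFinset, a r = a t → r = t) :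
    0 < ∑ r ∈ p.roots.toFinset, ∑ t ∈ p.roots.toFinset, (p.rootMultiplicity r : ℝ) *
      p.rootMultiplicity t * (a r - a t) ^ 2 := by
  obtain ⟨r, hr, t, ht, hrt⟩ := Finset.one_lt_card.1 hcard
  have hpos : ∀ r ∈ p.roots.toFinset, (0 : ℝ) < p.rootMultiplicity r := fun r hr => by
    rw [Multiset.mem_toFinset, mem_roots hp0] at hr
    exact_mod_cast (rootMultiplicity_pos hp0).2 hr
  refine Finset.sum_pos' (fun r _ => Finset.sum_nonneg fun t _ => by positivity) ⟨r, hr, ?_⟩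
  refine Finset.sum_pos' (fun t _ => by positivity) ⟨t, ht, ?_⟩
  have h1 := hpos r hr
  have h2 := hpos t ht
  have h3 : a r - a t ≠ 0 := fun h => hrt (ha r hr t ht (sub_eq_zero.1 h))
  positivity

theorem eval_diffPoly_neg {κ : ℝ} {p : ℝ[X]} (hp : p.Splits) (hp0 : p ≠ 0)
    (hcard : 2 ≤ p.roots.toFinset.card) (hκ : (p.natDegree : ℝ) - 1 - κ * p.natDegree ≤ 0)
    {x : ℝ} (hx : p.eval x ≠ 0) : (diffPoly κ p).eval x < 0 := by
  have h := natDegree_mul_eval_diffPoly (κ := κ) hp hx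
  have hne : ∀ r ∈ p.roots.toFinset, x - r ≠ 0 := fun r hr h0 => hx (by
    rw [sub_eq_zero.1 h0]
    rw [Multiset.mem_toFinset] at hr
    exact isRoot_of_mem_roots hr)
  have h1 := sum_sum_pos hp0 hcard (a := fun r => 1 / (x - r)) fun r hr t ht hrt => by
    simp only [one_div, inv_inj, sub_right_inj] at hrt
    exact hrt
  set V := ∑ r ∈ p.roots.toFinset, ∑ t ∈ p.roots.toFinset, (p.rootMultiplicity r : ℝ) *
      p.rootMultiplicity t * (1 / (x - r) - 1 / (x - t)) ^ 2
  have h2 : 0 < p.eval x ^ 2 * (V / 2) := by positivity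
  have h3 : p.eval x ^ 2 * ((1 - κ) * p.natDegree - 1)
      * (p.roots.map fun r => 1 / (x - r)).sum ^ 2 ≤ 0 := by
    refine mul_nonpos_of_nonpos_of_nonneg (mul_nonpos_of_nonneg_of_nonpos ?_ ?_) ?_
    · positivity
    · linarith
    · positivity
  have h4 : (p.natDegree : ℝ) * (diffPoly κ p).eval x < 0 := by linarith
  exact neg_of_mul_neg_right h4 (Nat.cast_nonneg _)

/-- At this κ only the variance survives. Since 1/(x - r) - 1/(x - t) is (r - t)/((x - r)(x - t)),
the quotient x⁴F/p² tends to a nonzero limit, so its numerator and denominator have equal degree. -/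
theorem natDegree_diffPoly_add_four {κ : ℝ} {p : ℝ[X]} (hp : p.Splits) (hp0 : p ≠ 0)
    (hcard : 2 ≤ p.roots.toFinset.card) (hκ : (p.natDegree : ℝ) - 1 - κ * p.natDegree = 0) :
    (diffPoly κ p).natDegree + 4 = 2 * p.natDegree := by
  set S := p.roots.toFinset with hS
  have hn : (p.natDegree : ℝ) ≠ 0 := by
    intro h
    rw [h] at hκ
    norm_num at hκ
  set L := ∑ r ∈ S, ∑ t ∈ S, (p.rootMultiplicity r : ℝ) * p.rootMultiplicity t * (r - t) ^ 2
    with hL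
  have hLpos : 0 < L := sum_sum_pos hp0 hcard (a := fun r => r) fun r _ t _ h => h
  have hquot : ∀ r : ℝ, Tendsto (fun x : ℝ => x / (x - r)) atTop (𝓝 1) := fun r => by
    have := div_tendsto_atTop_leadingCoeff_div_of_degree_eq (X : ℝ[X]) (X - C r) (by simp)
    simpa using this
  have hlim : Tendsto (fun x => (diffPoly κ p * X ^ 4).eval x / (p ^ 2).eval x) atTop
      (𝓝 (-(L / 2) / p.natDegree)) := by
    have h1 : Tendsto (fun x : ℝ => -((∑ r ∈ S, ∑ t ∈ S, (p.rootMultiplicity r : ℝ) *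
        p.rootMultiplicity t * ((r - t) ^ 2 * ((x / (x - r)) ^ 2 * (x / (x - t)) ^ 2))) / 2)
          / p.natDegree) atTop (𝓝 (-(L / 2) / p.natDegree)) := by
      refine Tendsto.div_const (Tendsto.neg (Tendsto.div_const ?_ _)) _
      refine tendsto_finsetSum _ fun r _ => tendsto_finsetSum _ fun t _ => ?_
      have := (((hquot r).pow 2).mul ((hquot t).pow 2)).const_mul ((r - t) ^ 2)
      have := this.const_mul ((p.rootMultiplicity r : ℝ) * p.rootMultiplicity t)
      simpa using this
    refine h1.congr' ?_
    filter_upwards [eventually_atTop_not_isRoot p hp0] with x hx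
    rw [IsRoot.def] at hx
    have h2 := natDegree_mul_eval_diffPoly (κ := κ) hp hx
    rw [show (1 - κ) * p.natDegree - 1 = 0 by linarith, mul_zero, zero_mul, zero_sub] at h2
    have hne : ∀ r ∈ S, x - r ≠ 0 := fun r hr h0 => hx (by
      rw [sub_eq_zero.1 h0]
      rw [hS, Multiset.mem_toFinset] at hr
      exact isRoot_of_mem_roots hr)
    have h3 : ∑ r ∈ S, ∑ t ∈ S, (p.rootMultiplicity r : ℝ) *
        p.rootMultiplicity t * ((r - t) ^ 2 * ((x / (x - r)) ^ 2 * (x / (x - t)) ^ 2))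
        = x ^ 4 * ∑ r ∈ S, ∑ t ∈ S, (p.rootMultiplicity r : ℝ) *
          p.rootMultiplicity t * (1 / (x - r) - 1 / (x - t)) ^ 2 := by
      simp only [Finset.mul_sum]
      refine Finset.sum_congr rfl fun r hr => Finset.sum_congr rfl fun t ht => ?_
      have e1 := hne r hr
      have e2 := hne t ht
      field_simp
      ring
    rw [h3]
    simp only [eval_mul, eval_pow, eval_X]
    rw [div_eq_div_iff hn (pow_ne_zero 2 hx)]
    linear_combination (-x ^ 4) * h2
  have hlim0 : -(L / 2) / p.natDegree ≠ 0 := div_ne_zero (by linarith) hn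
  have hq0 : p ^ 2 ≠ 0 := pow_ne_zero 2 hp0
  have hdeg : (diffPoly κ p * X ^ 4).degree = (p ^ 2).degree := by
    rcases lt_trichotomy (diffPoly κ p * X ^ 4).degree (p ^ 2).degree with h | h | h
    · exact absurd (tendsto_nhds_unique hlim (div_tendsto_atTop_zero_of_degree_lt _ _ h)) hlim0
    · exact h
    · exact absurd hlim.abs
        (not_tendsto_nhds_of_tendsto_atTop (abs_div_tendsto_atTop_atTop_of_degree_gt _ _ h hq0) _)
  have hF : diffPoly κ p ≠ 0 := by
    rintro h
    rw [h, zero_mul, degree_zero] at hdeg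
    exact hq0 (degree_eq_bot.1 hdeg.symm)
  have := natDegree_eq_of_degree_eq hdeg
  rwa [natDegree_mul hF (pow_ne_zero 4 X_ne_zero), natDegree_pow, natDegree_pow, natDegree_X] at this

/-- The cofactor does not vanish at a zero of p, so F has multiplicity exactly 2m - 2 there; these
sum to 2n - 2d with d the number of distinct zeroes. -/
theorem card_roots_diffPoly {κ : ℝ} {p : ℝ[X]} (hp : p.Splits) (hp0 : p ≠ 0)
    (hκ : ∀ x, p.eval x = 0 → (p.rootMultiplicity x : ℝ) - 1 - κ * p.rootMultiplicity x ≠ 0)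
    (hF : diffPoly κ p ≠ 0) :
    Multiset.card (diffPoly κ p).roots + 2 * p.roots.toFinset.card
      = zeroCountOn (diffPoly κ p) {x | p.eval x ≠ 0} + 2 * p.natDegree := by
  have hmem : ∀ x, x ∈ p.roots.toFinset ↔ p.eval x = 0 := fun x => by
    rw [Multiset.mem_toFinset, mem_roots hp0, IsRoot.def]
  have h1 : (Set.univ : Set ℝ) = {x | p.eval x ≠ 0} ∪ (p.roots.toFinset : Set ℝ) := by
    ext x
    by_cases hx : p.eval x = 0
    · simp only [Set.mem_univ, true_iff]
      exact Or.inr ((hmem x).2 hx)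
    · simp only [Set.mem_univ, true_iff]
      exact Or.inl hx
  have hdisj : Disjoint {x | p.eval x ≠ 0} (p.roots.toFinset : Set ℝ) := by
    rw [Set.disjoint_left]
    intro x hx hx'
    exact hx ((hmem x).1 hx')
  rw [← zeroCountOn_univ, h1, zeroCountOn_union _ hdisj, zeroCountOn_finset, add_assoc]
  congr 1
  have h2 : ∀ x ∈ p.roots.toFinset,
      (diffPoly κ p).rootMultiplicity x + 2 = 2 * p.rootMultiplicity x := by
    intro x hx
    have hx0 := (hmem x).1 hx
    obtain ⟨g, hg, c, hc, hgx⟩ := exists_diffPoly_eq_pow_mul κ hp0 hx0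
    have hgx0 : g.eval x ≠ 0 := by rw [hgx]; exact mul_ne_zero hc.ne' (hκ x hx0)
    have hpos := (rootMultiplicity_pos hp0).2 hx0
    have : (diffPoly κ p).rootMultiplicity x = 2 * p.rootMultiplicity x - 2 := by
      rw [hg] at hF
      rw [hg, rootMultiplicity_mul hF, rootMultiplicity_X_sub_C_pow,
        rootMultiplicity_eq_zero (p := g) hgx0, add_zero]
    omega
  have h3 := Finset.sum_congr rfl h2
  rw [Finset.sum_add_distrib, ← Finset.mul_sum, sum_rootMultiplicity hp, Finset.sum_const,
    smul_eq_mul] at h3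
  omega

/-! ### Assembling the six cases. -/

theorem rootMultiplicity_C_mul_prod {a₀ : ℝ} (ha₀ : a₀ ≠ 0) {d : ℕ} {lam : ℕ → ℝ}
    (hlam : StrictMonoOn lam (Set.Icc 1 d)) (mult : ℕ → ℕ) {k : ℕ} (hk : k ∈ Finset.Icc 1 d) :
    (C a₀ * ∏ k ∈ Finset.Icc 1 d, (X - C (lam k)) ^ mult k).rootMultiplicity (lam k) = mult k := by
  rw [← count_roots, roots_C_mul _ ha₀, roots_prod _ _ (Finset.prod_ne_zero_iff.2 fun k _ =>
    pow_ne_zero _ (X_sub_C_ne_zero _)), Multiset.count_bind]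
  change ∑ i ∈ Finset.Icc 1 d, Multiset.count (lam k) ((X - C (lam i)) ^ mult i).roots = mult k
  rw [Finset.sum_eq_single k]
  · simp
  · intro i hi hik
    have : lam k ≠ lam i := fun h =>
      hik (hlam.injOn (by simpa using hi) (by simpa using hk) h.symm)
    simp [this]
  · exact fun h => absurd hk h

theorem interior_card_le {d : ℕ} {mult : ℕ → ℕ} {m : ℕ → ℕ} {r j : ℕ} {P : ℕ → Prop}
    [DecidablePred P] (hmem : ∀ k ∈ Finset.Icc 2 (d - 1), ∃ i ∈ Set.Icc 1 r, m i = mult k)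
    (hP : ∀ k ∈ Finset.Icc 2 (d - 1), P k → ∀ i ∈ Set.Icc 1 r, m i = mult k → i ≤ j) :
    ((Finset.Icc 2 (d - 1)).filter P).card ≤ ∑ i ∈ Finset.Icc 1 j, interiorCount d mult (m i) := by
  refine le_trans (Finset.card_le_card fun k hk => ?_) Finset.card_biUnion_le
  obtain ⟨hk1, hk2⟩ := Finset.mem_filter.1 hk
  obtain ⟨i, hi, him⟩ := hmem k hk1
  exact Finset.mem_biUnion.2 ⟨i, Finset.mem_Icc.2 ⟨hi.1, hP k hk1 hk2 i hi him⟩,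
    Finset.mem_filter.2 ⟨hk1, him.symm⟩⟩

theorem theorem2p1
    (d : ℕ) (hd : 4 ≤ d)
    (a₀ : ℝ) (ha₀ : a₀ ≠ 0)
    (lam : ℕ → ℝ) (hlam : StrictMonoOn lam (Set.Icc 1 d))
    (mult : ℕ → ℕ) (hmult : ∀ k ∈ Finset.Icc 1 d, 1 ≤ mult k)
    (p : Polynomial ℝ)
    (hp : p = Polynomial.C a₀ *
      ∏ k ∈ Finset.Icc 1 d, (Polynomial.X - Polynomial.C (lam k)) ^ mult k)
    (n : ℕ) (hn : n = ∑ k ∈ Finset.Icc 1 d, mult k)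
    (r : ℕ) (hr : 2 ≤ r)
    (m : ℕ → ℕ) (hm : StrictMonoOn m (Set.Icc 1 r))
    (hmult_m : mult '' Set.Icc 2 (d - 1) = m '' Set.Icc 1 r)
    (κ : ℝ) :
    (κ ≤ ((m 1 : ℝ) - 1) / m 1 →
      nonrealZeroCount (diffPoly κ p) = 0) ∧
    (∀ j : ℕ, 1 ≤ j → j ≤ r - 1 →
      ((m j : ℝ) - 1) / m j < κ → κ ≤ ((m (j + 1) : ℝ) - 1) / m (j + 1) →
      nonrealZeroCount (diffPoly κ p) ≤
        2 * ∑ i ∈ Finset.Icc 1 j, interiorCount d mult (m i)) ∧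
    (((m r : ℝ) - 1) / m r < κ → κ < ((n : ℝ) - d + 1) / ((n : ℝ) - d + 2) →
      nonrealZeroCount (diffPoly κ p) ≤ 2 * d - 4) ∧
    (∀ k : ℕ, 2 ≤ k → k ≤ d - 1 →
      ((n : ℝ) - d + k - 1) / ((n : ℝ) - d + k) ≤ κ →
      κ < ((n : ℝ) - d + k) / ((n : ℝ) - d + k + 1) →
      2 * k - 2 ≤ nonrealZeroCount (diffPoly κ p) ∧
        nonrealZeroCount (diffPoly κ p) ≤ 2 * d - 4) ∧
    (κ = ((n : ℝ) - 1) / n →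
      nonrealZeroCount (diffPoly κ p) = 2 * d - 4) ∧
    (((n : ℝ) - 1) / n < κ →
      nonrealZeroCount (diffPoly κ p) = 2 * d - 2) := by
  have hne : ∏ k ∈ Finset.Icc 1 d, (X - C (lam k)) ^ mult k ≠ 0 :=
    Finset.prod_ne_zero_iff.2 fun k _ => pow_ne_zero _ (X_sub_C_ne_zero _)
  have hp0 : p ≠ 0 := by rw [hp]; exact mul_ne_zero (C_ne_zero.2 ha₀) hne
  have hs : p.Splits := by
    rw [hp]
    exact (Splits.prod fun k _ => (Splits.X_sub_C _).pow _).C_mul _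
  have hrm : ∀ k ∈ Finset.Icc 1 d, p.rootMultiplicity (lam k) = mult k := fun k hk => by
    rw [hp]; exact rootMultiplicity_C_mul_prod ha₀ hlam mult hk
  have hroot : ∀ x, p.eval x = 0 ↔ ∃ k ∈ Set.Icc 1 d, lam k = x := by
    intro x
    rw [hp, eval_mul, eval_C, mul_eq_zero, or_iff_right ha₀, eval_prod, Finset.prod_eq_zero_iff]
    constructor
    · rintro ⟨k, hk, h0⟩
      rw [eval_pow, eval_sub, eval_X, eval_C] at h0
      exact ⟨k, by simpa using hk, (sub_eq_zero.1 (pow_eq_zero_iff (Nat.one_le_iff_ne_zero.1 (hmult k hk)) |>.1 h0)).symm⟩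
    · rintro ⟨k, hk, rfl⟩
      have hk' : k ∈ Finset.Icc 1 d := by simpa using hk
      refine ⟨k, hk', ?_⟩
      have := hmult k hk'
      simp [show mult k ≠ 0 by omega]
  have hfin : p.roots.toFinset = (Finset.Icc 1 d).image lam := by
    ext x
    rw [Multiset.mem_toFinset, mem_roots hp0, IsRoot.def, hroot]
    simp
  have hinj : Set.InjOn lam (Finset.Icc 1 d : Finset ℕ) := by
    rw [Finset.coe_Icc]; exact hlam.injOn
  have hcard : p.roots.toFinset.card = d := by
    rw [hfin, Finset.card_image_of_injOn hinj, Nat.card_Icc]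
    omega
  have hdeg : p.natDegree = n := by
    rw [← sum_rootMultiplicity hs, hfin, Finset.sum_image hinj, hn]
    exact Finset.sum_congr rfl hrm
  -- The other d - 1 multiplicities are at least 1 each.
  have hbound : ∀ k ∈ Finset.Icc 1 d, mult k + d ≤ n + 1 := by
    intro k hk
    have h1 := Finset.add_sum_erase _ mult hk
    have h2 : ((Finset.Icc 1 d).erase k).card ≤ ∑ i ∈ (Finset.Icc 1 d).erase k, mult i := by
      rw [Finset.card_eq_sum_ones]
      exact Finset.sum_le_sum fun i hi => hmult i (Finset.mem_of_mem_erase hi)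
    rw [Finset.card_erase_of_mem hk, Nat.card_Icc] at h2
    omega
  have hdn : d ≤ n := by
    have h1 := hbound 1 (Finset.mem_Icc.2 ⟨le_rfl, by omega⟩)
    have h2 := hmult 1 (Finset.mem_Icc.2 ⟨le_rfl, by omega⟩)
    omega
  have hdnR : (d : ℝ) ≤ n := by exact_mod_cast hdn
  have hdR : (4 : ℝ) ≤ d := by exact_mod_cast hd
  have hnpos : (0 : ℝ) < n := by linarith
  have hboundR : ∀ x, p.eval x = 0 →
      1 ≤ (p.rootMultiplicity x : ℝ) ∧ (p.rootMultiplicity x : ℝ) ≤ n - d + 1 := by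
    intro x hx
    obtain ⟨k, hk, rfl⟩ := (hroot x).1 hx
    have hk' : k ∈ Finset.Icc 1 d := by simpa using hk
    have h1 := hbound k hk'
    have h2 := hmult k hk'
    rw [hrm k hk']
    constructor
    · exact_mod_cast h2
    · have : (mult k : ℝ) + d ≤ n + 1 := by exact_mod_cast h1
      linarith
  have hZ := nonrealZeroCount_add (diffPoly κ p)
  have hint : ∀ k ∈ Finset.Icc 2 (d - 1), ∃ i ∈ Set.Icc 1 r, m i = mult k := fun k hk => by
    have : mult k ∈ mult '' Set.Icc 2 (d - 1) := ⟨k, by simpa using hk, rfl⟩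
    rw [hmult_m] at this
    exact this
  have hmpos : ∀ i ∈ Set.Icc 1 r, 1 ≤ m i ∧ m i + d ≤ n + 1 := fun i hi => by
    have : m i ∈ m '' Set.Icc 1 r := ⟨i, hi, rfl⟩
    rw [← hmult_m] at this
    obtain ⟨k, hk, hk'⟩ := this
    have hk1 : k ∈ Finset.Icc 1 d := Finset.mem_Icc.2 ⟨by have := hk.1; omega, by
      have := hk.2; omega⟩
    rw [← hk']
    exact ⟨hmult k hk1, hbound k hk1⟩
  -- Upper bounds for the number of non-real zeroes.
  have hupper : 0 < (n : ℝ) - 1 - κ * n → nonrealZeroCount (diffPoly κ p) ≤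
      2 * ((Finset.Icc 2 (d - 1)).filter fun k =>
        (p.rootMultiplicity (lam k) : ℝ) - 1 - κ * p.rootMultiplicity (lam k) < 0).card := by
    intro hκ
    obtain ⟨⟨A, hA⟩, B, hB⟩ := exists_forall_le_eval_diffPoly_pos hdeg (by omega) hκ
    obtain ⟨mu, h0, h1, h⟩ := exists_interlacing hs (by omega) hlam hroot
      (A := min A (lam 1 - 1)) (B := max B (lam d + 1)) (by omega)
      ((min_le_right _ _).trans_lt (by linarith)) (lt_of_lt_of_le (by linarith) (le_max_right _ _))
    have := two_mul_sum_le_zeroCountOn_diffPoly hs (by omega) (by omega) h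
      (hA _ (by rw [h0]; exact min_le_left _ _)) (hB _ (by rw [h1]; exact le_max_left _ _))
    rw [Finset.sum_congr rfl hrm, ← hn, zeroCountOn_univ] at this
    rw [natDegree_diffPoly_eq hdeg (by omega) hκ.ne'] at hZ
    omega
  have hcardIcc : ∀ P : ℕ → Prop, ∀ [DecidablePred P],
      ((Finset.Icc 2 (d - 1)).filter P).card ≤ d - 2 := fun P _ => by
    refine (Finset.card_filter_le _ _).trans ?_
    rw [Nat.card_Icc]
    omega
  have hupper' : 0 < (n : ℝ) - 1 - κ * n → nonrealZeroCount (diffPoly κ p) ≤ 2 * d - 4 := by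
    intro hκ
    have h1 := hupper hκ
    have h2 := hcardIcc fun k =>
      (p.rootMultiplicity (lam k) : ℝ) - 1 - κ * p.rootMultiplicity (lam k) < 0
    omega
  -- The condition on κ says 1 ≤ (1 - κ)m with m = `m i₀`. It passes to every larger multiplicity,
  -- and becomes strict for n because m + d ≤ n + 1.
  have hbad : ∀ {i₀ : ℕ}, i₀ ∈ Set.Icc 1 r → κ ≤ ((m i₀ : ℝ) - 1) / m i₀ →
      0 < (n : ℝ) - 1 - κ * n ∧ ∀ k ∈ Finset.Icc 2 (d - 1),
        (p.rootMultiplicity (lam k) : ℝ) - 1 - κ * p.rootMultiplicity (lam k) < 0 →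
        ∀ i ∈ Set.Icc 1 r, m i = mult k → i < i₀ := by
    intro i₀ hi₀ hκ
    obtain ⟨h1, h2⟩ := hmpos i₀ hi₀
    have h1R : (1 : ℝ) ≤ m i₀ := by exact_mod_cast h1
    have h2R : (m i₀ : ℝ) + d ≤ n + 1 := by exact_mod_cast h2
    rw [le_div_iff₀ (by linarith)] at hκ
    have hκ' : 1 ≤ (1 - κ) * m i₀ := by linarith
    have hκ1 : 0 < 1 - κ := by
      by_contra! hneg
      nlinarith
    constructor
    · nlinarith
    · intro k hk hlt i hi hik
      by_contra! hle
      have hmono : m i₀ ≤ m i := hm.monotoneOn hi₀ hi hle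
      rw [hrm k (Finset.mem_Icc.2 ⟨by have := (Finset.mem_Icc.1 hk).1; omega, by
        have := (Finset.mem_Icc.1 hk).2; omega⟩), ← hik] at hlt
      have hmonoR : (m i₀ : ℝ) ≤ m i := by exact_mod_cast hmono
      nlinarith
  -- The count of real zeroes off the zeroes of `p`.
  have hcount : (∀ x, p.eval x = 0 →
      (p.rootMultiplicity x : ℝ) - 1 - κ * p.rootMultiplicity x ≠ 0) → diffPoly κ p ≠ 0 →
      nonrealZeroCount (diffPoly κ p) + zeroCountOn (diffPoly κ p) {x | p.eval x ≠ 0} + 2 * n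
        = (diffPoly κ p).natDegree + 2 * d := by
    intro h hF
    have := card_roots_diffPoly hs hp0 h hF
    rw [hcard, hdeg] at this
    omega
  have hlarge : (n : ℝ) - 1 - κ * n ≤ 0 → (∀ x, p.eval x = 0 →
      (p.rootMultiplicity x : ℝ) - 1 - κ * p.rootMultiplicity x ≠ 0) ∧ diffPoly κ p ≠ 0 ∧
      zeroCountOn (diffPoly κ p) {x | p.eval x ≠ 0} = 0 := by
    intro hκ
    have hneg : ∀ x, p.eval x ≠ 0 → (diffPoly κ p).eval x < 0 := fun x hx =>
      eval_diffPoly_neg hs hp0 (by omega) (by rw [hdeg]; exact hκ) hx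
    refine ⟨fun x hx h0 => ?_, ?_, zeroCountOn_eq_zero fun x hx => (hneg x hx).ne⟩
    · obtain ⟨h1, h2⟩ := hboundR x hx
      have h3 : (1 - κ) * p.rootMultiplicity x = 1 := by linarith
      have h4 : 0 < 1 - κ := by
        by_contra! hle
        nlinarith
      nlinarith
    · obtain ⟨x, hx⟩ := (eventually_atTop_not_isRoot p hp0).exists
      intro h
      have := hneg x hx
      rw [h, eval_zero] at this
      exact lt_irrefl _ this
  refine ⟨fun hκ => ?_, fun j hj1 hj2 _ hκ => ?_, fun _ hκ => hupper' ?_,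
    fun k hk1 hk2 hκ1 hκ2 => ?_, fun hκ => ?_, fun hκ => ?_⟩
  · obtain ⟨h1, h2⟩ := hbad ⟨le_rfl, by omega⟩ hκ
    have h3 := hupper h1
    have h4 := interior_card_le (j := 0) hint fun k hk hlt i hi hik =>
      Nat.le_of_lt_succ (h2 k hk hlt i hi hik)
    rw [Finset.Icc_eq_empty (a := 1) (b := 0) (by norm_num), Finset.sum_empty] at h4
    omega
  · obtain ⟨h1, h2⟩ := hbad ⟨by omega, by omega⟩ hκ
    have h3 := hupper h1
    have h4 := interior_card_le (j := j) hint fun k hk hlt i hi hik =>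
      Nat.le_of_lt_succ (h2 k hk hlt i hi hik)
    omega
  · rw [lt_div_iff₀ (by linarith)] at hκ
    have : 0 < 1 - κ := by
      by_contra! hle
      nlinarith
    nlinarith
  · have hk1R : (2 : ℝ) ≤ k := by exact_mod_cast hk1
    have hk2R : (k : ℝ) + 1 ≤ d := by exact_mod_cast (show k + 1 ≤ d by omega)
    rw [div_le_iff₀ (by linarith)] at hκ1
    rw [lt_div_iff₀ (by linarith)] at hκ2
    have hs1 : 0 < 1 - κ := by
      by_contra! hle
      nlinarith
    have hκn : 0 < (n : ℝ) - 1 - κ * n := by nlinarith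
    refine ⟨?_, hupper' hκn⟩
    -- The range of κ gives n - d + k ≤ ν < n, so n - ν ≤ d - k; every multiplicity is at most n - d
    -- + 1 < ν because k ≥ 2. At most 2(d - k) real zeroes off those of p leave at least 2k - 2
    -- non-real ones.
    set ν := 1 / (1 - κ) with hν
    have hκν : κ = 1 - 1 / ν := by rw [hν, one_div_one_div]; ring
    have hν1 : (n : ℝ) - d + k ≤ ν := by
      rw [hν, le_div_iff₀ hs1]
      linarith
    have hν2 : ν < n := by
      rw [hν, div_lt_iff₀ hs1]
      linarith
    have hR := zeroCountOn_diffPoly_le_of_sub_le (d - k) hs hdeg (by linarith) hν2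
      (by rw [Nat.cast_sub (by omega)]; linarith) fun x => by
        by_cases hx : p.eval x = 0
        · have := (hboundR x hx).2
          linarith
        · rw [rootMultiplicity_eq_zero (p := p) hx, Nat.cast_zero]
          linarith
    rw [← hκν] at hR
    have hD := natDegree_diffPoly_eq hdeg (by omega) hκn.ne'
    have hF : diffPoly κ p ≠ 0 := by
      intro h
      rw [h, natDegree_zero] at hD
      omega
    have hC := hcount (fun x hx h0 => by
      obtain ⟨h1, h2⟩ := hboundR x hx
      nlinarith) hF
    omega
  · rw [eq_div_iff hnpos.ne'] at hκ
    obtain ⟨h1, h2, h3⟩ := hlarge (by linarith)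
    have h4 := natDegree_diffPoly_add_four (κ := κ) hs hp0 (by omega) (by rw [hdeg]; linarith)
    have h5 := hcount h1 h2
    omega
  · rw [div_lt_iff₀ hnpos] at hκ
    obtain ⟨h1, h2, h3⟩ := hlarge (by linarith)
    have h4 := natDegree_diffPoly_eq (κ := κ) hdeg (by omega) (by linarith)
    have h5 := hcount h1 h2
    omega
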